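/- Let a framed loop of length 2 be a pair $(\gamma,V)$ of smooth 2-periodic maps $\mathbb{R}\to\mathbb{R}^3$ such that $\gamma$ is an immersion of length 2 (over one period) and $V$ is a unit normal field along $\gamma$. Put $T=\gamma'/\|\gamma'\|$, $W=T\times V$, $\frac{d}{ds}=\|\gamma'\|^{-1}\frac{d}{dt}$, $ds=\|\gamma'\|\,dt$, $\mathrm{tw}(\gamma,V)=\langle \frac{d}{ds}V,W\rangle$ (the twist rate). Let $\mathcal{M}$ be the set of framed loops of length 2 modulo translations and rotations (a translation acts on $\gamma$ only) and constant frame twists $(\gamma,V)\mapsto(\gamma,\cos(2\theta)V+\sin(2\theta)W)$, with the smooth structure in which smooth paths are the images of smooth one-parameter families of framed loops. The weighted total twist is $$\widetilde{\mathrm{Tw}}(\gamma,V)=\frac1{2\pi}\int_0^2 \mathrm{tw}(\gamma,V)\,\|\gamma'\|\,ds .$$ For variations $X_j=(\delta\gamma_j,\delta V_j)$, $j=1,2$, of a framed loop let $\lambda^{j}_{st}=\langle\frac{d}{ds}\delta\gamma_j,T\rangle$, $\lambda^{j}_{tw}=-\langle\delta V_j,W\rangle$, $\lambda^j_{1}=\langle\frac{d}{ds}\delta\gamma_j,W\rangle$,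 $\lambda^j_2=-\langle\frac{d}{ds}\delta\gamma_j,V\rangle$ and $$\omega(X_1,X_2)=\frac14\int_0^2\left(\lambda^1_{st}\lambda^2_{tw}-\lambda^1_{tw}\lambda^2_{st}+\lambda^1_{1}\lambda^2_{2}-\lambda^1_{2}\lambda^2_{1}\right)ds .$$ The basepoint action of $S^1=\mathbb{R}/2\mathbb{Z}$ on $\mathcal{M}$ is $u\cdot[\gamma,V]=[\gamma(\cdot+u),V(\cdot+u)]$. For $\Phi:\mathbb{R}\to\mathbb{C}^2$ let $\widehat{\mathrm{H}}(\Phi)=\left(\int_0^t \mathrm{Hopf}_1(\Phi)\,dt,\ \mathrm{Hopf}_2(\Phi)/\|\Phi\|^2\right)$ with $\mathrm{Hopf}_1(z,w)=(|z|^2-|w|^2,\,2\mathrm{Im}(z\overline w),\,2\mathrm{Re}(z\overline w))$ and $\mathrm{Hopf}_2(z,w)=(2\mathrm{Im}(zw),\,\mathrm{Re}(z^2+w^2),\,\mathrm{Im}(-z^2+w^2))$; $\Phi$ represents $m\in\mathcal{M}$ if $\widehat{\mathrm{H}}(\Phi)$ is a framed loop of length 2 with class $m$. For integers $h\ge1$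 and $k$ put $$\Phi_{h,k}(t)=\frac1{\sqrt2}\left(e^{\frac i2(k+h)\pi t},\,e^{\frac i2(k-h)\pi t}\right).$$ Theorem. (1) $\omega$ induces a well-defined form on $\mathcal{M}$: its value on the velocities of two smooth paths in $\mathcal{M}$ through a common point, computed from lifts with a common starting point, exists and does not depend on the lifts. The basepoint action is smooth, preserves $\omega$ and is Hamiltonian with moment map $\mu=-\frac{\pi}{2}\widetilde{\mathrm{Tw}}$: $\mu$ is invariant, and $d\mu(\delta)=\omega(\delta,X)$ for all tangent vectors $\delta$, where $X$ generates the action. (2) $[\gamma,V]$ is a critical point of $\widetilde{\mathrm{Tw}}:\mathcal{M}\to\mathbb{R}$ (its derivative along every smooth path through $[\gamma,V]$ vanishes there) if and only if $\gamma$ is an arclength-parameterized round circle covered $h$ times for some $h\geq 1$, and $V$ has constant twist rate. (3) $m\in\mathcal{M}$ is a critical point of $\widetilde{\mathrm{Tw}}$ if and only if $m$ is represented by $\Phi_{h,k}$ for some integers $h\ge1$ and $k$. For all integers $h\ge 1$ and $k$: $\Phi_{h,k}$ is smooth, zero-free, 2-periodic or 2-antiperiodic, has $L^2([0,2])$-orthonormal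 components, lies on the Clifford torus $|z|^2=|w|^2=\frac12$ and represents exactly one point of $\mathcal{M}$; it represents $[\gamma,V]$ if and only if $\gamma$ is an arclength-parameterized, $h$-times covered round circle and $V$ has constant twist rate $-\pi k$. -/

import Mathlib

open scoped ContDiff

noncomputable section

namespace FramedLoops

/-! ### Euclidean 3-space -/

/-- Euclidean 3-space. -/
abbrev E3 : Type := EuclideanSpace ℝ (Fin 3)

/-- The cross product of Euclidean 3-space. -/
def cross (a b : E3) : E3 := WithLp.toLp 2 (crossProduct (WithLp.ofLp a) (WithLp.ofLp b))

/-- The rotation group `SO(3)`. -/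
abbrev SO3 : Type := Matrix.specialOrthogonalGroup (Fin 3) ℝ

/-- The rotation action of `SO(3)` on Euclidean 3-space. -/
def rot (A : SO3) : E3 →ₗ[ℝ] E3 := Matrix.toEuclideanLin (A : Matrix (Fin 3) (Fin 3) ℝ)

/-! ### Framed loops and their moduli space -/

/-- A framed loop of length 2: the base curve `γ` is a smooth closed immersed curve parameterized
by the circle `ℝ / 2ℤ` (that is, a smooth 2-periodic curve), and the framing `V` is a smooth closed
unit normal vector field along `γ`. -/
@[ext]
structure FramedLoop where
  γ : ℝ → E3
  V : ℝ → E3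
  smooth_γ : ContDiff ℝ ∞ γ
  smooth_V : ContDiff ℝ ∞ V
  periodic_γ : Function.Periodic γ 2
  periodic_V : Function.Periodic V 2
  immersed : ∀ t, deriv γ t ≠ 0
  unit_V : ∀ t, ‖V t‖ = 1
  normal_V : ∀ t, inner ℝ (deriv γ t) (V t) = 0
  length_eq : ∫ t in (0 : ℝ)..2, ‖deriv γ t‖ = 2

namespace FramedLoop

/-- The speed `‖γ'‖`. -/
def speed (f : FramedLoop) (t : ℝ) : ℝ := ‖deriv f.γ t‖

/-- The unit tangent `T = γ' / ‖γ'‖`. -/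
def T (f : FramedLoop) (t : ℝ) : E3 := (f.speed t)⁻¹ • deriv f.γ t

/-- The third frame vector `W = T × V`. -/
def W (f : FramedLoop) (t : ℝ) : E3 := cross (f.T t) (f.V t)

/-- The twist rate `tw(γ, V) = ⟨dV/ds, W⟩`, where `d/ds = ‖γ'‖⁻¹ d/dt`. -/
def twistRate (f : FramedLoop) (t : ℝ) : ℝ :=
  inner ℝ ((f.speed t)⁻¹ • deriv f.V t) (f.W t)

/-- The weighted total twist `(1 / 2π) ∫ tw(γ, V) ‖γ'‖ ds`, where `ds = ‖γ'‖ dt`. -/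
def weightedTwist (f : FramedLoop) : ℝ :=
  1 / (2 * Real.pi) * ∫ t in (0 : ℝ)..2, f.twistRate t * f.speed t * f.speed t

/-- Two framed loops are identified when they differ by a rigid motion (the translation moves only
the base curve) and a constant frame twist. -/
def Rel (f g : FramedLoop) : Prop :=
  ∃ (A : SO3) (b : E3) (θ : ℝ), ∀ t, g.γ t = rot A (f.γ t) + b ∧
    g.V t = rot A (Real.cos (2 * θ) • f.V t + Real.sin (2 * θ) • f.W t)

end FramedLoop

theorem inner_eq (a b : E3) : inner ℝ a b = a 0 * b 0 + a 1 * b 1 + a 2 * b 2 := by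
  simp [PiLp.inner_apply, Fin.sum_univ_three]; ring

theorem inner_rot (A : SO3) (a b : E3) : inner ℝ (rot A a) (rot A b) = inner ℝ a b := by
  have hA : (A : Matrix (Fin 3) (Fin 3) ℝ).transpose * (A : Matrix (Fin 3) (Fin 3) ℝ) = 1 := by
    have := (Matrix.mem_specialOrthogonalGroup_iff.1 A.2).1
    exact (Matrix.mem_orthogonalGroup_iff' (Fin 3) ℝ).1 this
  rw [rot, ← LinearMap.adjoint_inner_right, ← Matrix.toEuclideanLin_conjTranspose_eq_adjoint]
  congr 1
  rw [Matrix.toLpLin_apply, Matrix.toLpLin_apply]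
  simp [Matrix.mulVec_mulVec, hA]

theorem norm_rot (A : SO3) (a : E3) : ‖rot A a‖ = ‖a‖ := by
  rw [@norm_eq_sqrt_real_inner E3, @norm_eq_sqrt_real_inner E3, inner_rot]

theorem rot_mul (A B : SO3) (a : E3) : rot (A * B) a = rot A (rot B a) := by
  simp [rot, Matrix.toLpLin_apply, Matrix.mulVec_mulVec]

theorem rot_one (a : E3) : rot 1 a = a := by
  simp [rot]

theorem cross_rot (A : SO3) (a b : E3) : cross (rot A a) (rot A b) = rot A (cross a b) := by
  have h := Matrix.mem_specialOrthogonalGroup_iff.1 A.2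
  have hA := (Matrix.mem_orthogonalGroup_iff (Fin 3) ℝ).1 h.1
  have hadj : (A : Matrix (Fin 3) (Fin 3) ℝ).adjugate.transpose = A := by
    have h1 := Matrix.adjugate_mul (A : Matrix (Fin 3) (Fin 3) ℝ)
    rw [h.2, one_smul] at h1
    have h2 : (A : Matrix (Fin 3) (Fin 3) ℝ).adjugate
        = (A : Matrix (Fin 3) (Fin 3) ℝ).transpose := by
      calc _ = (A : Matrix (Fin 3) (Fin 3) ℝ).adjugate *
            ((A : Matrix (Fin 3) (Fin 3) ℝ) * (A : Matrix (Fin 3) (Fin 3) ℝ).transpose) := by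
              have : (A : Matrix (Fin 3) (Fin 3) ℝ) *
                (A : Matrix (Fin 3) (Fin 3) ℝ).transpose = 1 := hA
              rw [this, mul_one]
        _ = _ := by rw [← mul_assoc, h1, one_mul]
    rw [h2, Matrix.transpose_transpose]
  have key : ∀ (M : Matrix (Fin 3) (Fin 3) ℝ) (x y : Fin 3 → ℝ),
      crossProduct (M.mulVec x) (M.mulVec y)
        = M.adjugate.transpose.mulVec (crossProduct x y) := by
    intro M x y
    ext i
    fin_cases i <;>
      simp [cross_apply, Matrix.mulVec, dotProduct, Fin.sum_univ_three,
        Matrix.adjugate_fin_three] <;> ring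
  simp only [cross, rot, Matrix.toLpLin_apply]
  rw [key, hadj]

theorem cross_smul_left (c : ℝ) (a b : E3) : cross (c • a) b = c • cross a b := by
  simp [cross]

theorem cross_smul_right (c : ℝ) (a b : E3) : cross a (c • b) = c • cross a b := by
  simp [cross]

theorem cross_add_right (a b c : E3) : cross a (b + c) = cross a b + cross a c := by
  simp [cross]

theorem cross_cross (a b : E3) (ha : inner ℝ a a = (1 : ℝ)) (hb : inner ℝ a b = (0 : ℝ)) :
    cross a (cross a b) = -b := by
  rw [inner_eq] at ha hb
  ext i
  fin_cases i <;> simp [cross, cross_apply]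
  · linear_combination a 0 * hb - b 0 * ha
  · linear_combination a 1 * hb - b 1 * ha
  · linear_combination a 2 * hb - b 2 * ha

theorem inner_cross_left (a b : E3) : inner ℝ a (cross a b) = (0 : ℝ) := by
  rw [inner_eq]; simp [cross, cross_apply]; ring

theorem inner_cross_right (a b : E3) : inner ℝ b (cross a b) = (0 : ℝ) := by
  rw [inner_eq]; simp [cross, cross_apply]; ring

namespace FramedLoop

variable (f g : FramedLoop)

theorem speed_pos (t : ℝ) : 0 < f.speed t := norm_pos_iff.2 (f.immersed t)

theorem inner_T_T (t : ℝ) : inner ℝ (f.T t) (f.T t) = (1 : ℝ) := by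
  have := (f.speed_pos t).ne'
  rw [T, real_inner_self_eq_norm_sq, norm_smul, norm_inv, Real.norm_eq_abs,
    abs_of_pos (f.speed_pos t)]
  have h : ‖deriv f.γ t‖ = f.speed t := rfl
  rw [h]; field_simp

theorem inner_T_V (t : ℝ) : inner ℝ (f.T t) (f.V t) = (0 : ℝ) := by
  rw [T, inner_smul_left, f.normal_V]; simp

theorem cross_T_W (t : ℝ) : cross (f.T t) (f.W t) = -f.V t :=
  cross_cross _ _ (f.inner_T_T t) (f.inner_T_V t)

theorem inner_V_W (t : ℝ) : inner ℝ (f.V t) (f.W t) = (0 : ℝ) := inner_cross_right _ _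

theorem inner_W_W (t : ℝ) : inner ℝ (f.W t) (f.W t) = (1 : ℝ) := by
  have hT := f.inner_T_T t
  have hV : inner ℝ (f.V t) (f.V t) = (1 : ℝ) := by
    rw [real_inner_self_eq_norm_sq, f.unit_V]; norm_num
  have hTV := f.inner_T_V t
  rw [inner_eq] at hT hV hTV
  rw [inner_eq, W]
  simp only [cross, cross_apply]
  simp
  linear_combination (f.V t 0 * f.V t 0 + f.V t 1 * f.V t 1 + f.V t 2 * f.V t 2) * hT + hV -
    (f.T t 0 * f.V t 0 + f.T t 1 * f.V t 1 + f.T t 2 * f.V t 2) * hTV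

theorem differentiable_γ : Differentiable ℝ f.γ := f.smooth_γ.differentiable (by simp)

theorem differentiable_V : Differentiable ℝ f.V := f.smooth_V.differentiable (by simp)

theorem differentiable_W : Differentiable ℝ f.W := by
  have h1 : ContDiff ℝ ∞ (deriv f.γ) := (contDiff_infty_iff_deriv.1 f.smooth_γ).2
  have h2 : Differentiable ℝ (deriv f.γ) := h1.differentiable (by simp)
  have hs : Differentiable ℝ f.speed := fun t => (h2 t).norm ℝ (f.immersed t)
  have hT : Differentiable ℝ f.T := fun t =>
    ((hs t).inv (f.speed_pos t).ne').smul (h2 t)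
  have hT' := fun i => (differentiable_euclidean.1 hT) i
  have hV' := fun i => (differentiable_euclidean.1 f.differentiable_V) i
  rw [differentiable_euclidean]
  intro i
  fin_cases i <;> simp [W, cross, cross_apply]
  · exact ((hT' 1).mul (hV' 2)).sub ((hT' 2).mul (hV' 1))
  · exact ((hT' 2).mul (hV' 0)).sub ((hT' 0).mul (hV' 2))
  · exact ((hT' 0).mul (hV' 1)).sub ((hT' 1).mul (hV' 0))

variable {f g}

theorem deriv_γ_of_eq {A : SO3} {b : E3} (h : ∀ t, g.γ t = rot A (f.γ t) + b) (t : ℝ) :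
    deriv g.γ t = rot A (deriv f.γ t) := by
  have h1 : g.γ = fun t => rot A (f.γ t) + b := funext h
  rw [h1]
  exact (((LinearMap.toContinuousLinearMap (rot A)).hasFDerivAt.comp_hasDerivAt t
    (f.differentiable_γ t).hasDerivAt).add_const b).deriv

theorem speed_of_eq {A : SO3} {b : E3} (h : ∀ t, g.γ t = rot A (f.γ t) + b) (t : ℝ) :
    g.speed t = f.speed t := by
  rw [speed, deriv_γ_of_eq h, norm_rot, speed]

theorem W_of_eq {A : SO3} {b : E3} {c s : ℝ} (h : ∀ t, g.γ t = rot A (f.γ t) + b)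
    (hV : ∀ t, g.V t = rot A (c • f.V t + s • f.W t)) (t : ℝ) :
    g.W t = rot A (c • f.W t - s • f.V t) := by
  have hT : g.T t = rot A (f.T t) := by
    rw [T, speed_of_eq h, deriv_γ_of_eq h, T, map_smul]
  rw [W, hT, hV, cross_rot, cross_add_right, cross_smul_right, cross_smul_right, cross_T_W]
  rw [smul_neg, ← sub_eq_add_neg, W]

theorem Rel.refl (f : FramedLoop) : Rel f f :=
  ⟨1, 0, 0, fun t => by simp [rot_one]⟩

theorem Rel.symm (h : Rel f g) : Rel g f := by
  obtain ⟨A, b, θ, h⟩ := h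
  have hi : ∀ x, rot A⁻¹ (rot A x) = x := fun x => by
    rw [← rot_mul, inv_mul_cancel, rot_one]
  refine ⟨A⁻¹, -rot A⁻¹ b, -θ, fun t => ⟨?_, ?_⟩⟩
  · rw [(h t).1, map_add, hi]; abel
  · rw [W_of_eq (fun t => (h t).1) (fun t => (h t).2), (h t).2]
    simp only [← map_smul, ← map_add, hi]
    rw [mul_neg, Real.cos_neg, Real.sin_neg]
    have := Real.sin_sq_add_cos_sq (2 * θ)
    calc f.V t = (Real.sin (2 * θ) ^ 2 + Real.cos (2 * θ) ^ 2) • f.V t := by rw [this, one_smul]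
      _ = _ := by module

theorem Rel.trans {k : FramedLoop} (h : Rel f g) (h' : Rel g k) : Rel f k := by
  obtain ⟨A, b, θ, h⟩ := h
  obtain ⟨B, c, η, h'⟩ := h'
  refine ⟨B * A, rot B b + c, θ + η, fun t => ⟨?_, ?_⟩⟩
  · rw [(h' t).1, (h t).1, rot_mul, map_add, add_assoc]
  · rw [(h' t).2, W_of_eq (fun t => (h t).1) (fun t => (h t).2), (h t).2, rot_mul]
    simp only [← map_smul, ← map_add]
    rw [mul_add, Real.cos_add, Real.sin_add]
    congr 2
    module

/-- Identification of framed loops up to rigid motions and constant frame twists. -/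
instance setoid : Setoid FramedLoop := ⟨Rel, Rel.refl, Rel.symm, Rel.trans⟩

theorem twistRate_eq (h : Rel f g) (t : ℝ) : g.twistRate t = f.twistRate t := by
  obtain ⟨A, b, θ, h⟩ := h
  have hd : deriv g.V t = rot A (Real.cos (2 * θ) • deriv f.V t +
      Real.sin (2 * θ) • deriv f.W t) := by
    have h1 : g.V = fun t => rot A (Real.cos (2 * θ) • f.V t + Real.sin (2 * θ) • f.W t) :=
      funext fun t => (h t).2
    rw [h1]
    exact ((LinearMap.toContinuousLinearMap (rot A)).hasFDerivAt.comp_hasDerivAt t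
      (((f.differentiable_V t).hasDerivAt.const_smul (Real.cos (2 * θ))).add
        ((f.differentiable_W t).hasDerivAt.const_smul (Real.sin (2 * θ))))).deriv
  have hV := (f.differentiable_V t).hasDerivAt
  have hW := (f.differentiable_W t).hasDerivAt
  have e1 : inner ℝ (f.V t) (deriv f.V t) = (0 : ℝ) := by
    have h1 := hV.inner ℝ hV
    have h2 : (fun t => inner ℝ (f.V t) (f.V t)) = fun _ => (1 : ℝ) := by
      funext t; rw [real_inner_self_eq_norm_sq, f.unit_V]; norm_num
    rw [h2] at h1
    have := h1.unique (hasDerivAt_const t (1 : ℝ))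
    rw [real_inner_comm (f.V t) (deriv f.V t)] at this
    rw [real_inner_comm] at this ⊢
    linarith
  have e2 : inner ℝ (f.W t) (deriv f.W t) = (0 : ℝ) := by
    have h1 := hW.inner ℝ hW
    have h2 : (fun t => inner ℝ (f.W t) (f.W t)) = fun _ => (1 : ℝ) := by
      funext t; rw [f.inner_W_W]
    rw [h2] at h1
    have := h1.unique (hasDerivAt_const t (1 : ℝ))
    rw [real_inner_comm (f.W t) (deriv f.W t)] at this
    rw [real_inner_comm] at this ⊢
    linarith
  have e3 : inner ℝ (f.V t) (deriv f.W t) + inner ℝ (deriv f.V t) (f.W t) = (0 : ℝ) := by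
    have h1 := hV.inner ℝ hW
    have h2 : (fun t => inner ℝ (f.V t) (f.W t)) = fun _ => (0 : ℝ) := by
      funext t; rw [f.inner_V_W]
    rw [h2] at h1
    exact h1.unique (hasDerivAt_const t (0 : ℝ))
  have e4 := Real.sin_sq_add_cos_sq (2 * θ)
  rw [twistRate, speed_of_eq (fun t => (h t).1), hd,
    W_of_eq (fun t => (h t).1) (fun t => (h t).2), twistRate, ← map_smul, inner_rot]
  simp only [inner_smul_left, inner_add_left, inner_sub_right, inner_smul_right]
  have f1 : inner ℝ (deriv f.V t) (f.V t) = (0 : ℝ) := by rw [real_inner_comm]; exact e1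
  have f2 : inner ℝ (deriv f.W t) (f.W t) = (0 : ℝ) := by rw [real_inner_comm]; exact e2
  have f3 : inner ℝ (deriv f.W t) (f.V t) = -inner ℝ (deriv f.V t) (f.W t) := by
    rw [real_inner_comm]; linarith
  simp only [conj_trivial]
  rw [f1, f2, f3]
  linear_combination (f.speed t)⁻¹ * inner ℝ (deriv f.V t) (f.W t) * e4

theorem weightedTwist_eq (h : f ≈ g) : f.weightedTwist = g.weightedTwist := by
  have h' : Rel f g := h
  have h1 : ∀ t, g.twistRate t = f.twistRate t := twistRate_eq h'
  obtain ⟨A, b, θ, h⟩ := h'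
  have h2 : ∀ t, g.speed t = f.speed t := speed_of_eq fun t => (h t).1
  simp only [weightedTwist, h1, h2]

/-! ### Moving the basepoint -/

/-- The framed loop `t ↦ (γ (t + u), V (t + u))`. -/
def shift (u : ℝ) (f : FramedLoop) : FramedLoop where
  γ t := f.γ (t + u)
  V t := f.V (t + u)
  smooth_γ := f.smooth_γ.comp (contDiff_id.add contDiff_const)
  smooth_V := f.smooth_V.comp (contDiff_id.add contDiff_const)
  periodic_γ t := by
    change f.γ (t + 2 + u) = f.γ (t + u)
    rw [add_right_comm]; exact f.periodic_γ _
  periodic_V t := by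
    change f.V (t + 2 + u) = f.V (t + u)
    rw [add_right_comm]; exact f.periodic_V _
  immersed t := by rw [deriv_comp_add_const]; exact f.immersed _
  unit_V t := f.unit_V _
  normal_V t := by rw [deriv_comp_add_const]; exact f.normal_V _
  length_eq := by
    have hp : Function.Periodic (fun t => ‖deriv f.γ t‖) 2 := fun t => by
      have h : f.γ = fun x => f.γ (x + 2) := funext fun x => (f.periodic_γ x).symm
      have h2 : deriv f.γ t = deriv (fun x => f.γ (x + 2)) t := congrArg (fun k => deriv k t) h
      rw [deriv_comp_add_const] at h2
      simp only [h2]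
    have h1 : ∀ t, deriv (fun t => f.γ (t + u)) t = deriv f.γ (t + u) := fun t => by
      rw [deriv_comp_add_const]
    simp only [h1]
    rw [intervalIntegral.integral_comp_add_right (fun t => ‖deriv f.γ t‖), zero_add,
      add_comm 2 u, hp.intervalIntegral_add_eq u 0, zero_add, f.length_eq]

theorem W_shift (u : ℝ) (f : FramedLoop) (t : ℝ) : (f.shift u).W t = f.W (t + u) := by
  have h1 : deriv (f.shift u).γ t = deriv f.γ (t + u) := deriv_comp_add_const f.γ u t
  simp only [W, T, speed, h1]
  rfl

theorem shift_rel (u : ℝ) (h : f ≈ g) : f.shift u ≈ g.shift u := by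
  obtain ⟨A, b, θ, h⟩ := (h : Rel f g)
  exact ⟨A, b, θ, fun t => ⟨(h (t + u)).1, by rw [W_shift]; exact (h (t + u)).2⟩⟩

end FramedLoop

/-- The moduli space `M` of framed loops: framed loops of length 2 modulo rigid motions and
constant frame twists. -/
def M : Type := Quotient FramedLoop.setoid

/-- The class of a framed loop in the moduli space. -/
def toM (f : FramedLoop) : M := Quotient.mk _ f

/-- The weighted total twist functional on the moduli space. -/
def weightedTotalTwist (m : M) : ℝ :=
  Quotient.lift FramedLoop.weightedTwist (fun _ _ h => FramedLoop.weightedTwist_eq h) m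

/-- Moving the basepoint by `u`, on the moduli space. -/
def shiftM (u : ℝ) (m : M) : M :=
  Quotient.map (FramedLoop.shift u) (fun _ _ h => FramedLoop.shift_rel u h) m

theorem shiftM_shiftM (u v : ℝ) (m : M) : shiftM u (shiftM v m) = shiftM (u + v) m := by
  induction m using Quotient.inductionOn with
  | h f =>
    refine congrArg toM (FramedLoop.ext ?_ ?_) <;> funext t <;>
      simp only [FramedLoop.shift, add_assoc]

theorem shiftM_zero (m : M) : shiftM 0 m = m := by
  induction m using Quotient.inductionOn with
  | h f => refine congrArg toM (FramedLoop.ext ?_ ?_) <;> funext t <;> simp [FramedLoop.shift]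

theorem shiftM_periodic (m : M) : Function.Periodic (fun u => shiftM u m) 2 := fun u => by
  induction m using Quotient.inductionOn with
  | h f =>
    refine congrArg toM (FramedLoop.ext ?_ ?_) <;> funext t <;>
      simp only [FramedLoop.shift, ← add_assoc]
    · exact f.periodic_γ _
    · exact f.periodic_V _

/-- The basepoint action of the circle `ℝ / 2ℤ` on the moduli space: `u` sends the class of
`(γ, V)` to the class of `t ↦ (γ (t + u), V (t + u))`. -/
instance basepointAction : AddAction (AddCircle (2 : ℝ)) M where
  vadd u m := (shiftM_periodic m).lift u
  zero_vadd m := shiftM_zero m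
  add_vadd u v m := by
    induction u using QuotientAddGroup.induction_on with
    | H u => induction v using QuotientAddGroup.induction_on with
      | H v => exact (shiftM_shiftM u v m).symm

/-! ### Smooth paths, critical points and the symplectic form -/

/-- A smooth one-parameter family of framed loops. -/
def SmoothFamily (F : ℝ → FramedLoop) : Prop :=
  ContDiff ℝ ∞ (fun p : ℝ × ℝ => (F p.1).γ p.2) ∧ ContDiff ℝ ∞ (fun p : ℝ × ℝ => (F p.1).V p.2)

/-- A smooth path in the moduli space: the image of a smooth family of framed loops. The tangent
vectors of the moduli space are the velocities of these paths. -/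
def SmoothPath (c : ℝ → M) : Prop :=
  ∃ F : ℝ → FramedLoop, SmoothFamily F ∧ ∀ ε, c ε = toM (F ε)

/-- A point `m` is a critical point of `μ` when the derivative of `μ` at `m` vanishes in every
direction. -/
def IsCriticalPoint (μ : M → ℝ) (m : M) : Prop :=
  ∀ c : ℝ → M, SmoothPath c → c 0 = m → HasDerivAt (fun ε => μ (c ε)) 0 0

/-- A variation `(δγ, δV)` of a framed loop. -/
structure Variation where
  δγ : ℝ → E3
  δV : ℝ → E3

/-- The velocity at parameter `0` of a family of framed loops. -/
def velocity (F : ℝ → FramedLoop) : Variation where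
  δγ t := deriv (fun ε => (F ε).γ t) 0
  δV t := deriv (fun ε => (F ε).V t) 0

namespace Variation

variable (f : FramedLoop) (X Y : Variation)

/-- The stretching component `⟨dδγ/ds, T⟩`. -/
def stretch (t : ℝ) : ℝ := inner ℝ ((f.speed t)⁻¹ • deriv X.δγ t) (f.T t)

/-- The component `-⟨δV, W⟩` of twisting in the negative direction around the curve. -/
def twist (t : ℝ) : ℝ := -inner ℝ (X.δV t) (f.W t)

/-- The component `⟨dδγ/ds, W⟩` of bending in the negative direction around `V`. -/
def bend₁ (t : ℝ) : ℝ := inner ℝ ((f.speed t)⁻¹ • deriv X.δγ t) (f.W t)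

/-- The component `-⟨dδγ/ds, V⟩` of bending in the negative direction around `W`. -/
def bend₂ (t : ℝ) : ℝ := -inner ℝ ((f.speed t)⁻¹ • deriv X.δγ t) (f.V t)

/-- The symplectic form `ω(X, Y) = g(J X, Y)` at the framed loop `f`. Here
`g(X, Y) = (1/4) ∫ (⟨dδγ₁/ds, dδγ₂/ds⟩ + ⟨δV₁, W⟩ ⟨δV₂, W⟩) ds` is one quarter of the integral of
the sum of the products of the four components of `X` and `Y`, and the complex structure `J` rotates
the stretching direction to the twisting direction and the first to the second bending direction. -/
def sympl : ℝ :=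
  1 / 4 * ∫ t in (0 : ℝ)..2,
    (X.stretch f t * Y.twist f t - X.twist f t * Y.stretch f t +
      X.bend₁ f t * Y.bend₂ f t - X.bend₂ f t * Y.bend₁ f t) * f.speed t

end Variation

/-- The symplectic form of the moduli space, which is induced by that of framed loops: it takes
the value `a` on the velocities at parameter `0` of the paths `c₁` and `c₂` through a common point,
computed from lifts of these paths that agree at `0`. -/
def OmegaValue (c₁ c₂ : ℝ → M) (a : ℝ) : Prop :=
  ∃ F₁ F₂ : ℝ → FramedLoop, SmoothFamily F₁ ∧ SmoothFamily F₂ ∧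
    (∀ ε, c₁ ε = toM (F₁ ε)) ∧ (∀ ε, c₂ ε = toM (F₂ ε)) ∧ F₁ 0 = F₂ 0 ∧
    Variation.sympl (F₁ 0) (velocity F₁) (velocity F₂) = a

/-- The basepoint action is a smooth symplectic action that is Hamiltonian with moment map `μ`:
`μ` is invariant and `dμ(δ) = ω(δ, X)`, where `X` is the vector field that generates the action. -/
structure IsHamiltonianWithMomentMap (μ : M → ℝ) : Prop where
  smooth : ∀ (u : ℝ → ℝ) (c : ℝ → M), ContDiff ℝ ∞ u → SmoothPath c →
    SmoothPath fun ε => (u ε : AddCircle (2 : ℝ)) +ᵥ c ε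
  symplectic : ∀ (u : AddCircle (2 : ℝ)) (c₁ c₂ : ℝ → M) (a : ℝ), OmegaValue c₁ c₂ a →
    OmegaValue (fun ε => u +ᵥ c₁ ε) (fun ε => u +ᵥ c₂ ε) a
  invariant : ∀ (u : AddCircle (2 : ℝ)) (m : M), μ (u +ᵥ m) = μ m
  moment : ∀ c : ℝ → M, SmoothPath c →
    ∃ a, OmegaValue c (fun ε => (ε : AddCircle (2 : ℝ)) +ᵥ c 0) a ∧
      HasDerivAt (fun ε => μ (c ε)) a 0

/-! ### Circles, complex coordinates and torus knots -/

/-- `γ` is an arclength-parameterized, `h`-times covered round circle (with domain the circle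
`ℝ / 2ℤ`). -/
def IsCoveredCircle (h : ℕ) (γ : ℝ → E3) : Prop :=
  (∀ t, ‖deriv γ t‖ = 1) ∧ ∃ (p e₁ e₂ : E3) (R : ℝ), 0 < R ∧ ‖e₁‖ = 1 ∧ ‖e₂‖ = 1 ∧
    inner ℝ e₁ e₂ = (0 : ℝ) ∧ ∀ t, γ t = p + R • (Real.cos (h * Real.pi * t) • e₁ +
      Real.sin (h * Real.pi * t) • e₂)

/-- The first column of the frame-Hopf map. -/
def hopf₁ (p : ℂ × ℂ) : E3 :=
  !₂[‖p.1‖ ^ 2 - ‖p.2‖ ^ 2, 2 * (p.1 * star p.2).im, 2 * (p.1 * star p.2).re]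

/-- The second column of the frame-Hopf map. -/
def hopf₂ (p : ℂ × ℂ) : E3 :=
  !₂[2 * (p.1 * p.2).im, (p.1 ^ 2 + p.2 ^ 2).re, (-p.1 ^ 2 + p.2 ^ 2).im]

/-- The base curve `t ↦ ∫₀ᵗ Hopf₁(Φ)`, based at the origin, of the framed path with complex
coordinates `Φ`. -/
def baseCurve (Φ : ℝ → ℂ × ℂ) (t : ℝ) : E3 := ∫ s in (0 : ℝ)..t, hopf₁ (Φ s)

/-- The framing `Hopf₂(Φ) / ‖Φ‖²` of the framed path with complex coordinates `Φ`. -/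
def framing (Φ : ℝ → ℂ × ℂ) (t : ℝ) : E3 := (‖(Φ t).1‖ ^ 2 + ‖(Φ t).2‖ ^ 2)⁻¹ • hopf₂ (Φ t)

/-- The path `Φ` in `ℂ²` represents the point `m` of the moduli space: the framed path with complex
coordinates `Φ` is a framed loop of class `m`. -/
def Represents (Φ : ℝ → ℂ × ℂ) (m : M) : Prop :=
  ∃ f : FramedLoop, f.γ = baseCurve Φ ∧ f.V = framing Φ ∧ toM f = m

/-- `Φ = (φ, ψ)` lies in the Stiefel manifold of `L²`-orthonormal 2-frames of smooth loops or of
smooth antiperiodic paths in `ℂ`, and has no zero. -/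
structure IsStiefelFrame (Φ : ℝ → ℂ × ℂ) : Prop where
  smooth : ContDiff ℝ ∞ Φ
  closed : (∀ t, Φ (t + 2) = Φ t) ∨ ∀ t, Φ (t + 2) = -Φ t
  ne_zero : ∀ t, Φ t ≠ 0
  norm_fst : ∫ t in (0 : ℝ)..2, ‖(Φ t).1‖ ^ 2 = 1
  norm_snd : ∫ t in (0 : ℝ)..2, ‖(Φ t).2‖ ^ 2 = 1
  orthogonal : ∫ t in (0 : ℝ)..2, (Φ t).1 * star (Φ t).2 = 0

/-- The Clifford torus in the unit sphere of `ℂ²`. -/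
def cliffordTorus : Set (ℂ × ℂ) := {p | ‖p.1‖ ^ 2 = 1 / 2 ∧ ‖p.2‖ ^ 2 = 1 / 2}

/-- The symmetric torus knot `Φ_{h,k}`. -/
def torusKnot (h : ℕ) (k : ℤ) (t : ℝ) : ℂ × ℂ :=
  ((1 / Real.sqrt 2 : ℝ) * Complex.exp (Complex.I / 2 * (k + h) * Real.pi * t),
    (1 / Real.sqrt 2 : ℝ) * Complex.exp (Complex.I / 2 * (k - h) * Real.pi * t))

end FramedLoops

end

open FramedLoops

/-!
The velocity of a smooth family of framed loops is recorded by `y = d/dt δγ` and by the twist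
`c = ⟨δV, W⟩`, and the symplectic form is a quarter of the integral over a period of

  `c₁ ⟨y₂, T⟩ - c₂ ⟨y₁, T⟩ + ‖γ'‖⁻¹ ⟨T, y₁ × y₂⟩`

(`Variation.sympl_eq`), which involves the normal frame only through the twists.

**The form on the quotient.** Two lifts of a path in the moduli space differ by rotations,
translations and frame twists that depend on the parameter. A closed curve has two orthogonal
tangents, and a rotation is determined by the images of these, so that the rotations depend
differentiably on the parameter (`differentiableAt_rot`). Consequently the velocities of the lifts
differ by an infinitesimal rotation `Ω` and an infinitesimal twist `η`
(`exists_velocity_of_equiv`). These change the density by `η₁ ⟨y₂, T⟩ - η₂ ⟨y₁, T⟩ + ⟨Ω₁, y₂⟩ -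
⟨Ω₂, y₁⟩ + ⟨Ω₁ × Ω₂, γ'⟩`, whose integral vanishes since the length is fixed and the curves close
(`sympl_eq_of_equiv`).

**The moment map.** The moving frame satisfies `δ⟨V', W⟩ = c' + ⟨V', δW⟩ - ⟨δV, W'⟩`. Hence the
derivative of the density of the weighted total twist is the total derivative of `c ‖γ'‖` minus the
density of the pairing with the generator `(γ', V')`
(`SmoothFamily.hasDerivAt_weightedTwist`).

**Critical points.** At a critical point all pairings with the generator vanish. Twisting the frame
by a multiple of the derivative of the speed shows that the speed is constant
(`speed_eq_one_of_critical`). Every small vector field along the curve is, up to a dilation, the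
velocity of a family of framed loops (`FramedLoop.exists_family`), and testing with a multiple of
`U'` shows that `U = (τ - tw) T + T' × T` is constant, where `τ` is the mean twist rate
(`deriv_eq_zero_of_critical`). The tangential part of `U' = 0` says that `tw` is constant. Then
`T' × T` is constant, so that `T` rotates uniformly in a plane (`exists_isCoveredCircle`).
Conversely, for circles with constant twist rate `U` is constant, and the pairing is the integral
of a derivative.

**Torus knots.** Two framings of the same unit speed curve rotate against each other with angular
velocity the difference of their twist rates (`FramedLoop.hasDerivAt_inner_V`). So the constant
twist rates of framed circles are the multiples of `π`, and such a rate together with the number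
of turns determines the class of a framed circle. The frame-Hopf map sends the torus knots to
representatives of these classes (`represents_torusKnot_iff`).
-/

noncomputable section

namespace FramedLoops

/-! ### Functions of two real variables -/

section TwoVariables

variable {E : Type*} [NormedAddCommGroup E] [NormedSpace ℝ E] {G : ℝ × ℝ → E}

theorem hasDerivAt_comp_prodMk_right (hG : ContDiff ℝ ∞ G) (ε t : ℝ) :
    HasDerivAt (fun ε => G (ε, t)) (fderiv ℝ G (ε, t) (1, 0)) ε :=
  ((hG.differentiable (by simp)) (ε, t)).hasFDerivAt.comp_hasDerivAt ε
    ((hasDerivAt_id ε).prodMk (hasDerivAt_const ε t))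

theorem hasDerivAt_comp_prodMk_left (hG : ContDiff ℝ ∞ G) (ε t : ℝ) :
    HasDerivAt (fun t => G (ε, t)) (fderiv ℝ G (ε, t) (0, 1)) t :=
  ((hG.differentiable (by simp)) (ε, t)).hasFDerivAt.comp_hasDerivAt t
    ((hasDerivAt_const t ε).prodMk (hasDerivAt_id t))

theorem contDiff_fderiv_const (hG : ContDiff ℝ ∞ G) (w : ℝ × ℝ) :
    ContDiff ℝ ∞ fun p => fderiv ℝ G p w :=
  (hG.fderiv_right (m := ∞) (by simp)).clm_apply contDiff_const

theorem contDiff_deriv_fst (hG : ContDiff ℝ ∞ G) :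
    ContDiff ℝ ∞ fun p : ℝ × ℝ => deriv (fun ε => G (ε, p.2)) p.1 := by
  simp only [fun p : ℝ × ℝ => (hasDerivAt_comp_prodMk_right hG p.1 p.2).deriv]
  exact contDiff_fderiv_const hG _

theorem contDiff_deriv_snd (hG : ContDiff ℝ ∞ G) :
    ContDiff ℝ ∞ fun p : ℝ × ℝ => deriv (fun t => G (p.1, t)) p.2 := by
  simp only [fun p : ℝ × ℝ => (hasDerivAt_comp_prodMk_left hG p.1 p.2).deriv]
  exact contDiff_fderiv_const hG _

theorem contDiff_slice_fst (hG : ContDiff ℝ ∞ G) (t : ℝ) : ContDiff ℝ ∞ fun ε => G (ε, t) :=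
  hG.comp (contDiff_id.prodMk contDiff_const)

theorem contDiff_slice_snd (hG : ContDiff ℝ ∞ G) (ε : ℝ) : ContDiff ℝ ∞ fun t => G (ε, t) :=
  hG.comp (contDiff_const.prodMk contDiff_id)

theorem deriv_deriv_comm (hG : ContDiff ℝ ∞ G) (ε t : ℝ) :
    deriv (fun t => deriv (fun ε => G (ε, t)) ε) t =
      deriv (fun ε => deriv (fun t => G (ε, t)) t) ε := by
  simp only [fun ε t => (hasDerivAt_comp_prodMk_left hG ε t).deriv,
    fun ε t => (hasDerivAt_comp_prodMk_right hG ε t).deriv]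
  have hd : ∀ w, DifferentiableAt ℝ (fderiv ℝ G) w := fun w =>
    ((hG.fderiv_right (m := ∞) (by simp)).differentiable (by simp)) w
  have h1 := (hasDerivAt_comp_prodMk_left (contDiff_fderiv_const hG (1, 0)) ε t).deriv
  have h2 := (hasDerivAt_comp_prodMk_right (contDiff_fderiv_const hG (0, 1)) ε t).deriv
  rw [h1, h2, fderiv_clm_apply (hd _) (by fun_prop), fderiv_clm_apply (hd _) (by fun_prop)]
  simp only [fderiv_fun_const, Pi.zero_apply, ContinuousLinearMap.comp_zero, zero_add,
    ContinuousLinearMap.flip_apply]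
  exact (hG.contDiffAt.isSymmSndFDerivAt
    (by simpa using (WithTop.coe_le_coe.2 le_top : ((2 : ℕ∞) : WithTop ℕ∞) ≤ ∞))).eq _ _

/-- Differentiation under the integral sign for a smooth integrand. -/
theorem hasDerivAt_integral_of_contDiff (hG : ContDiff ℝ ∞ G) (a b ε : ℝ) :
    HasDerivAt (fun ε => ∫ t in a..b, G (ε, t))
      (∫ t in a..b, deriv (fun ε => G (ε, t)) ε) ε := by
  have hD := (contDiff_deriv_fst hG).continuous
  obtain ⟨C, hC⟩ := ((isCompact_Icc (a := ε - 1) (b := ε + 1)).prod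
    (isCompact_uIcc (a := a) (b := b))).exists_bound_of_continuousOn hD.continuousOn
  refine (intervalIntegral.hasDerivAt_integral_of_dominated_loc_of_deriv_le
    (F := fun ε t => G (ε, t)) (F' := fun ε t => deriv (fun ε => G (ε, t)) ε) (bound := fun _ => C)
    (Icc_mem_nhds (sub_one_lt ε) (lt_add_one ε)) ?_ ?_ ?_ ?_ ?_ ?_).2
  · exact .of_forall fun x => (contDiff_slice_snd hG x).continuous.aestronglyMeasurable
  · exact (contDiff_slice_snd hG ε).continuous.intervalIntegrable _ _
  · exact (hD.comp (Continuous.prodMk_right ε)).aestronglyMeasurable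
  · exact .of_forall fun t ht x hx => hC (x, t) ⟨hx, Set.uIoc_subset_uIcc ht⟩
  · exact intervalIntegrable_const
  · exact .of_forall fun t _ x _ =>
      (hasDerivAt_comp_prodMk_right hG x t).differentiableAt.hasDerivAt

theorem contDiff_integral (hG : ContDiff ℝ ∞ G) (a b : ℝ) :
    ContDiff ℝ ∞ fun ε => ∫ t in a..b, G (ε, t) := by
  refine contDiff_infty.2 fun n => ?_
  induction n generalizing G with
  | zero =>
    exact contDiff_zero.2 (continuous_iff_continuousAt.2 fun ε =>
      (hasDerivAt_integral_of_contDiff hG a b ε).continuousAt)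
  | succ n ih =>
    have h : ContDiff ℝ ((n : WithTop ℕ∞) + 1) fun ε => ∫ t in a..b, G (ε, t) := by
      refine contDiff_succ_iff_deriv.2 ⟨fun ε =>
        (hasDerivAt_integral_of_contDiff hG a b ε).differentiableAt, by simp, ?_⟩
      rw [funext fun ε => (hasDerivAt_integral_of_contDiff hG a b ε).deriv]
      exact ih (contDiff_deriv_fst hG)
    exact_mod_cast h

end TwoVariables

theorem contDiff_deriv {E : Type*} [NormedAddCommGroup E] [NormedSpace ℝ E] {x : ℝ → E}
    (hx : ContDiff ℝ ∞ x) : ContDiff ℝ ∞ (deriv x) :=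
  (contDiff_infty_iff_deriv.1 hx).2

theorem hasDerivAt_deriv {E : Type*} [NormedAddCommGroup E] [NormedSpace ℝ E] {x : ℝ → E}
    (hx : ContDiff ℝ ∞ x) (t : ℝ) : HasDerivAt x (deriv x t) t :=
  ((hx.differentiable (by simp)) t).hasDerivAt

theorem deriv_periodic {E : Type*} [NormedAddCommGroup E] [NormedSpace ℝ E] {x : ℝ → E} {T : ℝ}
    (hx : Function.Periodic x T) : Function.Periodic (deriv x) T := fun t => by
  have h : (fun s => x (s + T)) = x := funext hx
  rw [← deriv_comp_add_const, h]

/-- The derivative of a periodic function has integral zero over a period. -/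
theorem integral_deriv_eq_zero {E : Type*} [NormedAddCommGroup E] [NormedSpace ℝ E]
    [CompleteSpace E] {x : ℝ → E} (hx : ContDiff ℝ ∞ x) {T : ℝ} (hp : Function.Periodic x T) :
    ∫ t in (0 : ℝ)..T, deriv x t = 0 := by
  rw [intervalIntegral.integral_deriv_eq_sub (fun t _ => (hasDerivAt_deriv hx t).differentiableAt)
    ((contDiff_deriv hx).continuous.intervalIntegrable _ _)]
  rw [← zero_add T, hp 0, sub_self]

/-- A continuous nonnegative function with vanishing integral over a period vanishes. -/
theorem eq_zero_of_integral_eq_zero {x : ℝ → ℝ} (hx : Continuous x) (h0 : ∀ t, 0 ≤ x t)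
    {T : ℝ} (hT : 0 < T) (hp : Function.Periodic x T) (hi : ∫ t in (0 : ℝ)..T, x t = 0) (t : ℝ) :
    x t = 0 := by
  by_contra hne
  have h1 : ∫ s in t..(t + T), x s = 0 := by rw [hp.intervalIntegral_add_eq t 0, zero_add, hi]
  have h2 := intervalIntegral.integral_pos (a := t) (b := t + T) (by linarith) hx.continuousOn
    (fun s _ => h0 s) ⟨t, ⟨le_rfl, by linarith⟩, lt_of_le_of_ne (h0 t) (Ne.symm hne)⟩
  linarith

/-! ### The cross product -/

theorem cross_add_left (a b c : E3) : cross (a + b) c = cross a c + cross b c := by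
  simp [cross]

/-- The cross product as a continuous bilinear map. -/
def crossL : E3 →L[ℝ] E3 →L[ℝ] E3 :=
  (LinearMap.mk₂ ℝ cross cross_add_left cross_smul_left cross_add_right
    cross_smul_right).toContinuousBilinearMap

theorem contDiff_cross {F : Type*} [NormedAddCommGroup F] [NormedSpace ℝ F] {a b : F → E3}
    (ha : ContDiff ℝ ∞ a) (hb : ContDiff ℝ ∞ b) :
    ContDiff ℝ ∞ fun x => cross (a x) (b x) :=
  (crossL.contDiff.comp ha).clm_apply hb

theorem hasDerivAt_cross {a b : ℝ → E3} {a' b' : E3} {t : ℝ} (ha : HasDerivAt a a' t)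
    (hb : HasDerivAt b b' t) :
    HasDerivAt (fun s => cross (a s) (b s))
      (cross a' (b t) + cross (a t) b') t :=
  ((crossL.hasFDerivAt.comp_hasDerivAt t ha).clm_apply hb)

theorem inner_cross_comm (a b c : E3) : inner ℝ (cross a b) c = inner ℝ a (cross b c) := by
  simp only [inner_eq, cross, cross_apply]; simp; ring

theorem cross_swap (a b : E3) : cross a b = -cross b a := by
  ext i; fin_cases i <;> simp [cross, cross_apply] <;> ring

theorem cross_self (a : E3) : cross a a = 0 := by
  simp [cross]

theorem cross_cross_left (a b c : E3) :
    cross a (cross b c) = inner ℝ a c • b - inner ℝ a b • c := by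
  ext i; fin_cases i <;> simp [inner_eq, cross, cross_apply] <;> ring

theorem inner_cross_cross (a b c d : E3) :
    inner ℝ (cross a b) (cross c d) =
      (inner ℝ a c * inner ℝ b d - inner ℝ a d * inner ℝ b c : ℝ) := by
  simp only [inner_eq, cross, cross_apply]; simp; ring

/-- The cross product of a pair of vectors does not change when the pair is rotated. -/
theorem cross_rotate (φ : ℝ) (a b : E3) : cross (Real.cos φ • a + Real.sin φ • b)
    (-Real.sin φ • a + Real.cos φ • b) = cross a b := by
  simp only [cross_add_left, cross_add_right, cross_smul_left, cross_smul_right, cross_self,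
    cross_swap b a]
  calc _ = (Real.cos φ ^ 2 + Real.sin φ ^ 2) • cross a b := by module
    _ = _ := by rw [Real.cos_sq_add_sin_sq, one_smul]

/-! ### Uniform rotations -/

theorem hasDerivAt_cos_mul (a t : ℝ) :
    HasDerivAt (fun t => Real.cos (a * t)) (-Real.sin (a * t) * a) t := by
  simpa using ((hasDerivAt_id t).const_mul a).cos

theorem hasDerivAt_sin_mul (a t : ℝ) :
    HasDerivAt (fun t => Real.sin (a * t)) (Real.cos (a * t) * a) t := by
  simpa using ((hasDerivAt_id t).const_mul a).sin

/-! ### The adapted orthonormal frame -/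

namespace FramedLoop

variable (f : FramedLoop)

theorem deriv_γ_eq (t : ℝ) : deriv f.γ t = f.speed t • f.T t := by
  rw [T, smul_inv_smul₀ (f.speed_pos t).ne']

theorem inner_V_V (t : ℝ) : inner ℝ (f.V t) (f.V t) = (1 : ℝ) := by
  rw [real_inner_self_eq_norm_sq, f.unit_V]; norm_num

theorem inner_T_W (t : ℝ) : inner ℝ (f.T t) (f.W t) = (0 : ℝ) := inner_cross_left _ _

theorem inner_V_T (t : ℝ) : inner ℝ (f.V t) (f.T t) = (0 : ℝ) := by
  rw [real_inner_comm, inner_T_V]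

theorem inner_W_T (t : ℝ) : inner ℝ (f.W t) (f.T t) = (0 : ℝ) := by
  rw [real_inner_comm, inner_T_W]

theorem inner_W_V (t : ℝ) : inner ℝ (f.W t) (f.V t) = (0 : ℝ) := by
  rw [real_inner_comm, inner_V_W]

theorem cross_V_W (t : ℝ) : cross (f.V t) (f.W t) = f.T t := by
  rw [W, cross_cross_left, inner_V_V, real_inner_comm, inner_T_V]; simp

/-- Expansion of a vector in the orthonormal frame `T, V, W`. -/
theorem eq_frame_sum (t : ℝ) (x : E3) :
    x = (inner ℝ x (f.T t) : ℝ) • f.T t + (inner ℝ x (f.V t) : ℝ) • f.V t +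
      (inner ℝ x (f.W t) : ℝ) • f.W t := by
  rw [← sub_eq_zero]
  set z := x - _ with hz
  have hT : inner ℝ z (f.T t) = (0 : ℝ) := by
    simp only [hz, inner_sub_left, inner_add_left, inner_smul_left, conj_trivial,
      inner_T_T, inner_V_T, inner_W_T]
    ring
  have hV : inner ℝ z (f.V t) = (0 : ℝ) := by
    simp only [hz, inner_sub_left, inner_add_left, inner_smul_left, conj_trivial,
      inner_T_V, inner_V_V, inner_W_V]
    ring
  have hW : inner ℝ z (f.W t) = (0 : ℝ) := by
    simp only [hz, inner_sub_left, inner_add_left, inner_smul_left, conj_trivial,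
      inner_T_W, inner_V_W, inner_W_W]
    ring
  -- `z` is parallel to `W = T × V` because `z × W = ⟨z, V⟩ T - ⟨z, T⟩ V`, and orthogonal to it.
  have h := inner_cross_cross z (f.W t) z (f.W t)
  have h0 : cross z (f.W t) = 0 := by rw [W, cross_cross_left, hT, hV]; simp
  rw [h0, hW, inner_W_W, inner_zero_left] at h
  rw [mul_one, zero_mul, sub_zero] at h
  exact inner_self_eq_zero.1 h.symm

theorem inner_eq_frame_sum (t : ℝ) (x y : E3) :
    (inner ℝ x y : ℝ) = inner ℝ x (f.T t) * inner ℝ y (f.T t) +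
      inner ℝ x (f.V t) * inner ℝ y (f.V t) + inner ℝ x (f.W t) * inner ℝ y (f.W t) := by
  conv_lhs => rw [f.eq_frame_sum t y]
  simp only [inner_add_right, inner_smul_right]
  ring

theorem inner_T_cross (t : ℝ) (x y : E3) :
    (inner ℝ (f.T t) (cross x y) : ℝ) = inner ℝ x (f.V t) * inner ℝ y (f.W t) -
      inner ℝ x (f.W t) * inner ℝ y (f.V t) := by
  rw [← f.cross_V_W t, inner_cross_cross]
  simp only [real_inner_comm x, real_inner_comm y]
  ring

end FramedLoop

/-! ### Smooth families of framed loops -/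

theorem smoothFamily_const (f : FramedLoop) : SmoothFamily fun _ => f :=
  ⟨f.smooth_γ.comp contDiff_snd, f.smooth_V.comp contDiff_snd⟩

namespace SmoothFamily

variable {F : ℝ → FramedLoop} (hF : SmoothFamily F)
include hF

theorem deriv_γ : ContDiff ℝ ∞ fun p : ℝ × ℝ => deriv (F p.1).γ p.2 :=
  contDiff_deriv_snd hF.1

theorem deriv_V : ContDiff ℝ ∞ fun p : ℝ × ℝ => deriv (F p.1).V p.2 :=
  contDiff_deriv_snd hF.2

theorem speed : ContDiff ℝ ∞ fun p : ℝ × ℝ => (F p.1).speed p.2 :=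
  hF.deriv_γ.norm ℝ fun p => (F p.1).immersed p.2

theorem T : ContDiff ℝ ∞ fun p : ℝ × ℝ => (F p.1).T p.2 :=
  (hF.speed.inv fun p => ((F p.1).speed_pos p.2).ne').smul hF.deriv_γ

theorem W : ContDiff ℝ ∞ fun p : ℝ × ℝ => (F p.1).W p.2 :=
  contDiff_cross hF.T hF.2

theorem velocity_δγ : ContDiff ℝ ∞ (velocity F).δγ :=
  contDiff_slice_snd (contDiff_deriv_fst hF.1) 0

theorem velocity_δV : ContDiff ℝ ∞ (velocity F).δV :=
  contDiff_slice_snd (contDiff_deriv_fst hF.2) 0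

theorem hasDerivAt_V (t : ℝ) : HasDerivAt (fun ε => (F ε).V t) ((velocity F).δV t) 0 :=
  hasDerivAt_deriv (contDiff_slice_fst hF.2 t) 0

theorem hasDerivAt_deriv_γ (t : ℝ) :
    HasDerivAt (fun ε => deriv (F ε).γ t) (deriv (velocity F).δγ t) 0 := by
  have h := deriv_deriv_comm hF.1 0 t
  change deriv (velocity F).δγ t = _ at h
  rw [h]
  exact hasDerivAt_deriv (contDiff_slice_fst hF.deriv_γ t) 0

theorem hasDerivAt_deriv_V (t : ℝ) :
    HasDerivAt (fun ε => deriv (F ε).V t) (deriv (velocity F).δV t) 0 := by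
  have h := deriv_deriv_comm hF.2 0 t
  change deriv (velocity F).δV t = _ at h
  rw [h]
  exact hasDerivAt_deriv (contDiff_slice_fst hF.deriv_V t) 0

theorem hasDerivAt_speed (t : ℝ) :
    HasDerivAt (fun ε => (F ε).speed t)
      (inner ℝ (deriv (velocity F).δγ t) ((F 0).T t)) 0 := by
  have h1 := hasDerivAt_deriv (contDiff_slice_fst hF.speed t) 0
  have h2 := h1.mul h1
  have h3 := (hF.hasDerivAt_deriv_γ t).inner ℝ (hF.hasDerivAt_deriv_γ t)
  have h4 : (fun ε => (F ε).speed t * (F ε).speed t) =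
      fun ε => inner ℝ (deriv (F ε).γ t) (deriv (F ε).γ t) := by
    funext ε; rw [real_inner_self_eq_norm_mul_norm]; rfl
  have h5 := h2.unique (by rw [← h4] at h3; exact h3)
  have hv := (F 0).speed_pos t
  rw [(F 0).deriv_γ_eq, inner_smul_left, inner_smul_right,
    real_inner_comm (deriv (velocity F).δγ t)] at h5
  simp only [conj_trivial] at h5
  have h6 : inner ℝ (deriv (velocity F).δγ t) ((F 0).T t) =
      deriv (fun ε => (F ε).speed t) 0 := mul_left_cancel₀ hv.ne' (by linarith)
  rw [h6]
  exact h1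

end SmoothFamily

theorem velocity_δγ_periodic (F : ℝ → FramedLoop) : Function.Periodic (velocity F).δγ 2 :=
  fun t => by simp only [velocity, (F _).periodic_γ t]

theorem velocity_δV_periodic (F : ℝ → FramedLoop) : Function.Periodic (velocity F).δV 2 :=
  fun t => by simp only [velocity, (F _).periodic_V t]

namespace FramedLoop

variable (f : FramedLoop)

theorem contDiff_deriv_γ : ContDiff ℝ ∞ (deriv f.γ) := contDiff_deriv f.smooth_γ

theorem contDiff_speed : ContDiff ℝ ∞ f.speed :=
  contDiff_slice_snd (smoothFamily_const f).speed 0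

theorem contDiff_T : ContDiff ℝ ∞ f.T := contDiff_slice_snd (smoothFamily_const f).T 0

theorem contDiff_W : ContDiff ℝ ∞ f.W := contDiff_slice_snd (smoothFamily_const f).W 0

theorem speed_periodic : Function.Periodic f.speed 2 := fun t => by
  simp only [speed, deriv_periodic f.periodic_γ t]

theorem T_periodic : Function.Periodic f.T 2 := fun t => by
  simp only [T, f.speed_periodic t, deriv_periodic f.periodic_γ t]

theorem W_periodic : Function.Periodic f.W 2 := fun t => by
  simp only [W, f.T_periodic t, f.periodic_V t]

end FramedLoop

/-- The first-order form of the length constraint. -/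
theorem SmoothFamily.integral_inner_T_eq_zero {F : ℝ → FramedLoop} (hF : SmoothFamily F) :
    ∫ t in (0 : ℝ)..2, (inner ℝ (deriv (velocity F).δγ t) ((F 0).T t) : ℝ) = 0 := by
  have h := hasDerivAt_integral_of_contDiff hF.speed 0 2 0
  have h1 : (fun ε => ∫ t in (0 : ℝ)..2, (F ε).speed t) = fun _ => 2 :=
    funext fun ε => (F ε).length_eq
  have h2 := h.unique (by simpa only [h1] using hasDerivAt_const (0 : ℝ) (2 : ℝ))
  refine Eq.trans ?_ h2
  exact intervalIntegral.integral_congr fun t _ => (hF.hasDerivAt_speed t).deriv.symm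

/-- The first-order form of the closing condition. -/
theorem SmoothFamily.integral_inner_const_eq_zero {F : ℝ → FramedLoop} (hF : SmoothFamily F)
    (Ω : E3) : ∫ t in (0 : ℝ)..2, (inner ℝ Ω (deriv (velocity F).δγ t) : ℝ) = 0 := by
  have h : ∀ t, HasDerivAt (fun t => (inner ℝ Ω ((velocity F).δγ t) : ℝ))
      (inner ℝ Ω (deriv (velocity F).δγ t)) t := fun t => by
    simpa using (hasDerivAt_const t Ω).inner ℝ (hasDerivAt_deriv hF.velocity_δγ t)
  simp only [← fun t => (h t).deriv]
  exact integral_deriv_eq_zero (contDiff_const.inner ℝ hF.velocity_δγ) fun t => by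
    simp only [velocity_δγ_periodic F t]

theorem FramedLoop.integral_inner_deriv_γ (f : FramedLoop) (Ω : E3) :
    ∫ t in (0 : ℝ)..2, (inner ℝ Ω (deriv f.γ t) : ℝ) = 0 := by
  have h : ∀ t, HasDerivAt (fun t => (inner ℝ Ω (f.γ t) : ℝ)) (inner ℝ Ω (deriv f.γ t)) t :=
    fun t => by simpa using (hasDerivAt_const t Ω).inner ℝ (hasDerivAt_deriv f.smooth_γ t)
  simp only [← fun t => (h t).deriv]
  exact integral_deriv_eq_zero (contDiff_const.inner ℝ f.smooth_γ) fun t => by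
    simp only [f.periodic_γ t]

/-! ### The symplectic form without the normal frame -/

namespace Variation

/-- The density of `4 ω` with respect to `dt`, written in a form that involves the normal frame
only through the twist `⟨δV, W⟩`. -/
def density (f : FramedLoop) (X Y : Variation) (t : ℝ) : ℝ :=
  inner ℝ (X.δV t) (f.W t) * inner ℝ (deriv Y.δγ t) (f.T t) -
    inner ℝ (Y.δV t) (f.W t) * inner ℝ (deriv X.δγ t) (f.T t) +
      (f.speed t)⁻¹ * inner ℝ (f.T t) (cross (deriv X.δγ t) (deriv Y.δγ t))

theorem sympl_eq (f : FramedLoop) (X Y : Variation) :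
    sympl f X Y = 1 / 4 * ∫ t in (0 : ℝ)..2, density f X Y t := by
  rw [sympl]
  congr 1
  refine intervalIntegral.integral_congr fun t _ => ?_
  have hv := (f.speed_pos t).ne'
  simp only [stretch, twist, bend₁, bend₂, density, f.inner_T_cross, inner_smul_left, conj_trivial]
  field_simp
  ring

end Variation

/-! ### The group of rigid motions and frame twists -/

theorem hasDerivAt_rot (A : SO3) {x : ℝ → E3} {x' : E3} {t : ℝ} (h : HasDerivAt x x' t) :
    HasDerivAt (fun s => rot A (x s)) (rot A x') t :=
  (LinearMap.toContinuousLinearMap (rot A)).hasFDerivAt.comp_hasDerivAt t h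

theorem contDiff_rot {E : Type*} [NormedAddCommGroup E] [NormedSpace ℝ E] (A : SO3) {x : E → E3}
    (h : ContDiff ℝ ∞ x) : ContDiff ℝ ∞ fun s => rot A (x s) :=
  (LinearMap.toContinuousLinearMap (rot A)).contDiff.comp h

namespace FramedLoop

/-- The image of a framed loop under the rotation `A`, the translation `b` and the frame twist by
the angle `2θ`. -/
def act (A : SO3) (b : E3) (θ : ℝ) (f : FramedLoop) : FramedLoop where
  γ t := rot A (f.γ t) + b
  V t := rot A (Real.cos (2 * θ) • f.V t + Real.sin (2 * θ) • f.W t)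
  smooth_γ := (contDiff_rot A f.smooth_γ).add contDiff_const
  smooth_V := contDiff_rot A ((f.smooth_V.const_smul _).add (f.contDiff_W.const_smul _))
  periodic_γ t := by simp only [f.periodic_γ t]
  periodic_V t := by simp only [f.periodic_V t, f.W_periodic t]
  immersed t := by
    rw [((hasDerivAt_rot A (hasDerivAt_deriv f.smooth_γ t)).add_const b).deriv, ← norm_ne_zero_iff,
      norm_rot]
    exact norm_ne_zero_iff.2 (f.immersed t)
  unit_V t := by
    rw [norm_rot, norm_eq_sqrt_real_inner, Real.sqrt_eq_one]
    simp only [inner_add_left, inner_add_right, inner_smul_left, inner_smul_right, conj_trivial,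
      inner_V_V, inner_W_W, inner_V_W, inner_W_V]
    linear_combination Real.cos_sq_add_sin_sq (2 * θ)
  normal_V t := by
    rw [((hasDerivAt_rot A (hasDerivAt_deriv f.smooth_γ t)).add_const b).deriv, inner_rot,
      f.deriv_γ_eq, inner_smul_left, inner_add_right, inner_smul_right, inner_smul_right,
      inner_T_V, inner_T_W]
    simp
  length_eq := by
    simp only [fun t => ((hasDerivAt_rot A (hasDerivAt_deriv f.smooth_γ t)).add_const b).deriv,
      norm_rot]
    exact f.length_eq

theorem act_equiv (A : SO3) (b : E3) (θ : ℝ) (f : FramedLoop) : f ≈ act A b θ f :=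
  ⟨A, b, θ, fun _ => ⟨rfl, rfl⟩⟩

theorem exists_act_eq {f g : FramedLoop} (h : f ≈ g) : ∃ A b θ, act A b θ f = g := by
  obtain ⟨A, b, θ, h⟩ := (h : Rel f g)
  exact ⟨A, b, θ, FramedLoop.ext (funext fun t => (h t).1.symm) (funext fun t => (h t).2.symm)⟩

end FramedLoop

theorem SmoothFamily.act {F : ℝ → FramedLoop} (hF : SmoothFamily F) (A : SO3) (b : E3) (θ : ℝ) :
    SmoothFamily fun ε => (F ε).act A b θ :=
  ⟨(contDiff_rot A hF.1).add contDiff_const,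
    contDiff_rot A ((hF.2.const_smul _).add (hF.W.const_smul _))⟩

/-- A smooth path through the class of `f` lifts to a smooth family through `f`. -/
theorem SmoothPath.exists_lift {c : ℝ → M} (hc : SmoothPath c) {f : FramedLoop}
    (h : c 0 = toM f) : ∃ F, SmoothFamily F ∧ (∀ ε, c ε = toM (F ε)) ∧ F 0 = f := by
  obtain ⟨F, hF, hcF⟩ := hc
  obtain ⟨A, b, θ, hA⟩ := FramedLoop.exists_act_eq (Quotient.exact ((hcF 0).symm.trans h))
  exact ⟨_, hF.act A b θ, fun ε => (hcF ε).trans (Quotient.sound (FramedLoop.act_equiv A b θ _)),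
    hA⟩

/-! ### Paths of rotations -/

/-- The derivative of a path of rotations is the rotation followed by an infinitesimal rotation
`x ↦ Ω × x`. -/
theorem exists_angular_velocity {A : ℝ → SO3}
    (h : ∀ x, DifferentiableAt ℝ (fun ε => rot (A ε) x) 0) :
    ∃ Ω : E3, ∀ (x : ℝ → E3) (x' : E3), HasDerivAt x x' 0 →
      HasDerivAt (fun ε => rot (A ε) (x ε)) (rot (A 0) (x' + cross Ω (x 0))) 0 := by
  let e : Fin 3 → E3 := fun i => EuclideanSpace.single i 1
  let s : Fin 3 → E3 := fun i => rot (A 0)⁻¹ (deriv (fun ε => rot (A ε) (e i)) 0)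
  have hs : ∀ i, HasDerivAt (fun ε => rot (A ε) (e i)) (rot (A 0) (s i)) 0 := fun i => by
    have h1 : rot (A 0) (s i) = deriv (fun ε => rot (A ε) (e i)) 0 := by
      rw [← rot_mul, mul_inv_cancel, rot_one]
    rw [h1]
    exact (h (e i)).hasDerivAt
  have hskew : ∀ i j, s i j + s j i = 0 := fun i j => by
    have h1 := (hs i).inner ℝ (hs j)
    simp only [inner_rot] at h1
    have h2 := h1.unique (hasDerivAt_const _ _)
    simp [e, EuclideanSpace.inner_single_left, EuclideanSpace.inner_single_right] at h2
    linarith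
  have hsum : ∀ x : E3, x = x 0 • e 0 + x 1 • e 1 + x 2 • e 2 := fun x => by
    ext i; fin_cases i <;> simp [e]
  refine ⟨!₂[s 1 2, s 2 0, s 0 1], fun x x' hx => ?_⟩
  have hxi : ∀ i, HasDerivAt (fun ε => x ε i) (x' i) 0 := fun i =>
    (EuclideanSpace.proj (𝕜 := ℝ) i).hasFDerivAt.comp_hasDerivAt 0 hx
  have h1 := (((hxi 0).smul (hs 0)).add ((hxi 1).smul (hs 1))).add ((hxi 2).smul (hs 2))
  have h2 : (fun ε => rot (A ε) (x ε)) = fun ε => x ε 0 • rot (A ε) (e 0) +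
      x ε 1 • rot (A ε) (e 1) + x ε 2 • rot (A ε) (e 2) := funext fun ε => by
    conv_lhs => rw [hsum (x ε)]
    simp only [map_add, map_smul]
  rw [h2]
  refine h1.congr_deriv ?_
  simp only [← map_smul, ← map_add]
  congr 1
  have d0 := hskew 0 0
  have d1 := hskew 1 1
  have d2 := hskew 2 2
  have d01 := hskew 0 1
  have d02 := hskew 0 2
  have d12 := hskew 1 2
  ext i
  fin_cases i <;> simp [e, cross, cross_apply]
  · linear_combination x 0 0 * d0 / 2 + x 0 1 * d01
  · linear_combination x 0 1 * d1 / 2 + x 0 2 * d12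
  · linear_combination x 0 2 * d2 / 2 + x 0 0 * d02

/-- Cramer's rule for the basis `u, w, u × w`. -/
theorem inner_self_cross_smul (u w x : E3) :
    (inner ℝ (cross u w) (cross u w) : ℝ) • x = (inner ℝ (cross u w) x : ℝ) • cross u w +
      ((inner ℝ x w : ℝ) • cross (cross u w) u - (inner ℝ x u : ℝ) • cross (cross u w) w) := by
  have h1 := cross_cross_left (cross u w) x (cross u w)
  have h2 := cross_cross_left x u w
  have h3 : cross (cross u w) (cross x (cross u w)) =
      (inner ℝ x w : ℝ) • cross (cross u w) u - (inner ℝ x u : ℝ) • cross (cross u w) w := by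
    rw [h2, sub_eq_add_neg, ← neg_smul, cross_add_right, cross_smul_right, cross_smul_right]
    module
  rw [← h3, h1]
  abel

/-- A rotation is determined by its values on two vectors. -/
theorem inner_self_cross_smul_rot (A : SO3) (u w x : E3) :
    (inner ℝ (cross u w) (cross u w) : ℝ) • rot A x =
      (inner ℝ (cross u w) x : ℝ) • cross (rot A u) (rot A w) +
      ((inner ℝ x w : ℝ) • cross (cross (rot A u) (rot A w)) (rot A u) -
        (inner ℝ x u : ℝ) • cross (cross (rot A u) (rot A w)) (rot A w)) := by
  rw [← map_smul, inner_self_cross_smul]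
  simp only [cross_rot, map_add, map_sub, map_smul]

/-- Since a closed curve has two orthogonal tangents, its tangents span a plane. -/
theorem FramedLoop.exists_cross_ne_zero (f : FramedLoop) :
    ∃ t, (inner ℝ (cross (deriv f.γ 0) (deriv f.γ t)) (cross (deriv f.γ 0) (deriv f.γ t)) : ℝ)
      ≠ 0 := by
  have hd : ∀ t, HasDerivAt (fun t => (inner ℝ (deriv f.γ 0) (f.γ t) : ℝ))
      (inner ℝ (deriv f.γ 0) (deriv f.γ t)) t := fun t => by
    simpa using (hasDerivAt_const t (deriv f.γ 0)).inner ℝ (hasDerivAt_deriv f.smooth_γ t)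
  obtain ⟨t, -, ht⟩ := exists_hasDerivAt_eq_zero (a := 0) (b := 2) two_pos
    (fun s _ => (hd s).continuousAt.continuousWithinAt)
    (by simp only [← f.periodic_γ 0, zero_add]) (fun s _ => hd s)
  refine ⟨t, ?_⟩
  rw [inner_cross_cross, ht, zero_mul, sub_zero]
  exact mul_ne_zero (inner_self_ne_zero.2 (f.immersed 0)) (inner_self_ne_zero.2 (f.immersed t))

theorem rot_eq_of_deriv_eq (f : FramedLoop) {A B : SO3}
    (h : ∀ t, rot A (deriv f.γ t) = rot B (deriv f.γ t)) (x : E3) : rot A x = rot B x := by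
  obtain ⟨t, ht⟩ := f.exists_cross_ne_zero
  apply smul_right_injective E3 ht
  simp only [inner_self_cross_smul_rot, h]

/-- The rotations that relate two smooth families form a differentiable path: they are determined
by two of the tangent vectors of the loops. -/
theorem differentiableAt_rot {F G : ℝ → FramedLoop} (hF : SmoothFamily F) (hG : SmoothFamily G)
    {A : ℝ → SO3} (h : ∀ ε t, deriv (G ε).γ t = rot (A ε) (deriv (F ε).γ t)) (x : E3) :
    DifferentiableAt ℝ (fun ε => rot (A ε) x) 0 := by
  obtain ⟨t, ht⟩ := (F 0).exists_cross_ne_zero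
  have hu := (hF.hasDerivAt_deriv_γ 0)
  have hw := (hF.hasDerivAt_deriv_γ t)
  have hu' := (hG.hasDerivAt_deriv_γ 0)
  have hw' := (hG.hasDerivAt_deriv_γ t)
  have hn := hasDerivAt_cross hu hw
  have hn' := hasDerivAt_cross hu' hw'
  have hx := hasDerivAt_const (0 : ℝ) x
  have hD := hn.inner ℝ hn
  have hN := ((hn.inner ℝ hx).smul hn').add (((hx.inner ℝ hw).smul (hasDerivAt_cross hn' hu')).sub
    ((hx.inner ℝ hu).smul (hasDerivAt_cross hn' hw')))
  refine ((hD.inv ht).smul hN).differentiableAt.congr_of_eventuallyEq ?_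
  filter_upwards [hD.continuousAt.eventually_ne ht] with ε hε
  change _ = (inner ℝ (cross (deriv (F ε).γ 0) (deriv (F ε).γ t))
    (cross (deriv (F ε).γ 0) (deriv (F ε).γ t)) : ℝ)⁻¹ • (_ : E3)
  rw [eq_inv_smul_iff₀ hε, inner_self_cross_smul_rot]
  simp only [h]
  rfl

/-! ### Independence of the lifts -/

theorem cross_sub_right (a b c : E3) : cross a (b - c) = cross a b - cross a c := by
  simp [cross]

theorem SmoothFamily.hasDerivAt_W {F : ℝ → FramedLoop} (hF : SmoothFamily F) (t : ℝ) :
    HasDerivAt (fun ε => (F ε).W t) (deriv (fun ε => (F ε).W t) 0) 0 :=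
  hasDerivAt_deriv (contDiff_slice_fst hF.W t) 0

theorem SmoothFamily.inner_δV_V {F : ℝ → FramedLoop} (hF : SmoothFamily F) (t : ℝ) :
    (inner ℝ ((velocity F).δV t) ((F 0).V t) : ℝ) = 0 := by
  have h := (hF.hasDerivAt_V t).inner ℝ (hF.hasDerivAt_V t)
  simp only [FramedLoop.inner_V_V] at h
  have h1 := h.unique (hasDerivAt_const _ _)
  rw [real_inner_comm] at h1
  linarith

theorem SmoothFamily.inner_δW_W {F : ℝ → FramedLoop} (hF : SmoothFamily F) (t : ℝ) :
    (inner ℝ (deriv (fun ε => (F ε).W t) 0) ((F 0).W t) : ℝ) = 0 := by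
  have h := (hF.hasDerivAt_W t).inner ℝ (hF.hasDerivAt_W t)
  simp only [FramedLoop.inner_W_W] at h
  have h1 := h.unique (hasDerivAt_const _ _)
  rw [real_inner_comm] at h1
  linarith

theorem SmoothFamily.inner_δW_V {F : ℝ → FramedLoop} (hF : SmoothFamily F) (t : ℝ) :
    (inner ℝ (deriv (fun ε => (F ε).W t) 0) ((F 0).V t) : ℝ) =
      -inner ℝ ((velocity F).δV t) ((F 0).W t) := by
  have h := (hF.hasDerivAt_V t).inner ℝ (hF.hasDerivAt_W t)
  simp only [FramedLoop.inner_V_W] at h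
  have h1 := h.unique (hasDerivAt_const _ _)
  rw [real_inner_comm] at h1
  linarith

/-- The velocities of two lifts of the same path differ by a rotation and by the velocity of an
infinitesimal rotation `Ω` and frame twist `η`. -/
theorem exists_velocity_of_equiv {F G : ℝ → FramedLoop} (hF : SmoothFamily F) (hG : SmoothFamily G)
    (h : ∀ ε, F ε ≈ G ε) : ∃ (A : SO3) (Ω : E3) (η : ℝ),
      (∀ t, deriv (G 0).γ t = rot A (deriv (F 0).γ t)) ∧
      (∀ t, deriv (velocity G).δγ t =
        rot A (deriv (velocity F).δγ t + cross Ω (deriv (F 0).γ t))) ∧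
      ∀ t, (inner ℝ ((velocity G).δV t) ((G 0).W t) : ℝ) =
        inner ℝ ((velocity F).δV t) ((F 0).W t) + inner ℝ Ω ((F 0).T t) + η := by
  choose A b θ h using fun ε => (h ε : FramedLoop.Rel (F ε) (G ε))
  have hγ : ∀ ε t, deriv (G ε).γ t = rot (A ε) (deriv (F ε).γ t) := fun ε t =>
    FramedLoop.deriv_γ_of_eq (fun t => (h ε t).1) t
  have hW : ∀ ε t, (G ε).W t = rot (A ε)
      (Real.cos (2 * θ ε) • (F ε).W t - Real.sin (2 * θ ε) • (F ε).V t) := fun ε t =>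
    FramedLoop.W_of_eq (fun t => (h ε t).1) (fun t => (h ε t).2) t
  obtain ⟨Ω, hΩ⟩ := exists_angular_velocity (differentiableAt_rot hF hG hγ)
  -- The coefficients of the frame twist are inner products of differentiable vectors.
  have hc : ∃ c', HasDerivAt (fun ε => Real.cos (2 * θ ε)) c' 0 := by
    refine ⟨_, ((hG.hasDerivAt_V 0).inner ℝ (hΩ _ _ (hF.hasDerivAt_V 0))).congr_of_eventuallyEq
      (.of_forall fun ε => ?_)⟩
    simp only [(h ε 0).2, inner_rot, inner_add_left, inner_smul_left, FramedLoop.inner_V_V,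
      FramedLoop.inner_W_V, conj_trivial, mul_one, mul_zero, add_zero]
  have hs : ∃ s', HasDerivAt (fun ε => Real.sin (2 * θ ε)) s' 0 := by
    refine ⟨_, ((hG.hasDerivAt_V 0).inner ℝ (hΩ _ _ (hF.hasDerivAt_W 0))).congr_of_eventuallyEq
      (.of_forall fun ε => ?_)⟩
    simp only [(h ε 0).2, inner_rot, inner_add_left, inner_smul_left, FramedLoop.inner_V_W,
      FramedLoop.inner_W_W, conj_trivial, mul_one, mul_zero, zero_add]
  obtain ⟨c', hc⟩ := hc
  obtain ⟨s', hs⟩ := hs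
  refine ⟨A 0, Ω, Real.cos (2 * θ 0) * s' - Real.sin (2 * θ 0) * c', hγ 0, fun t => ?_,
    fun t => ?_⟩
  · exact (hG.hasDerivAt_deriv_γ t).unique
      ((hΩ _ _ (hF.hasDerivAt_deriv_γ t)).congr_of_eventuallyEq (.of_forall fun ε => hγ ε t))
  · have hV := (hG.hasDerivAt_V t).unique ((hΩ _ _ ((hc.smul (hF.hasDerivAt_V t)).add
      (hs.smul (hF.hasDerivAt_W t)))).congr_of_eventuallyEq (.of_forall fun ε => (h ε t).2))
    rw [hV, hW, inner_rot, inner_add_left, inner_cross_comm]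
    have hTW : cross (Real.cos (2 * θ 0) • (F 0).V t + Real.sin (2 * θ 0) • (F 0).W t)
        (Real.cos (2 * θ 0) • (F 0).W t - Real.sin (2 * θ 0) • (F 0).V t) = (F 0).T t := by
      simp only [cross_sub_right, cross_add_left, cross_smul_left, cross_smul_right, cross_self,
        cross_swap ((F 0).W t), (F 0).cross_V_W t]
      calc _ = (Real.cos (2 * θ 0) ^ 2 + Real.sin (2 * θ 0) ^ 2) • (F 0).T t := by module
        _ = _ := by rw [Real.cos_sq_add_sin_sq, one_smul]
    have e := Real.cos_sq_add_sin_sq (2 * θ 0)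
    change inner ℝ _ _ + inner ℝ Ω (cross (Real.cos (2 * θ 0) • (F 0).V t +
      Real.sin (2 * θ 0) • (F 0).W t) _) = _
    rw [hTW]
    simp only [inner_add_left, inner_sub_right, inner_smul_left, inner_smul_right, conj_trivial,
      hF.inner_δV_V, hF.inner_δW_W, hF.inner_δW_V, FramedLoop.inner_V_V, FramedLoop.inner_W_W,
      FramedLoop.inner_V_W, FramedLoop.inner_W_V]
    linear_combination (inner ℝ ((velocity F).δV t) ((F 0).W t) : ℝ) * e

/-- How infinitesimal rotations `Ωᵢ` of the vectors `yᵢ` change the bending part of the density of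
the symplectic form at a unit tangent vector `T`. -/
theorem inner_cross_add_cross_smul (T y₁ y₂ Ω₁ Ω₂ : E3) (v : ℝ) (hT : inner ℝ T T = (1 : ℝ)) :
    (inner ℝ T (cross (y₁ + cross Ω₁ (v • T)) (y₂ + cross Ω₂ (v • T))) : ℝ) =
      inner ℝ T (cross y₁ y₂) + v * (inner ℝ y₁ T * inner ℝ Ω₂ T - inner ℝ Ω₂ y₁ -
        inner ℝ y₂ T * inner ℝ Ω₁ T + inner ℝ Ω₁ y₂) + v ^ 2 * inner ℝ (cross Ω₁ Ω₂) T := by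
  have h1 : cross y₁ (cross Ω₂ T) = _ := cross_cross_left _ _ _
  have h2 : cross (cross Ω₁ T) y₂ = _ := (cross_swap _ _).trans
    (congrArg Neg.neg (cross_cross_left _ _ _))
  have h3 : cross (cross Ω₁ T) (cross Ω₂ T) = _ := cross_cross_left _ _ _
  simp only [cross_add_left, cross_add_right, cross_smul_left, cross_smul_right, h1, h2, h3,
    inner_add_right, inner_sub_right, inner_smul_right, inner_neg_right, hT]
  have h4 : inner ℝ (cross Ω₁ T) T = (0 : ℝ) := by
    rw [inner_cross_comm, cross_self, inner_zero_right]
  have h5 : (inner ℝ (cross Ω₁ T) Ω₂ : ℝ) = -inner ℝ (cross Ω₁ Ω₂) T := by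
    rw [inner_cross_comm, cross_swap, inner_neg_right, inner_cross_comm]
  rw [h4, h5, real_inner_comm Ω₁ T, real_inner_comm Ω₂ T, real_inner_comm Ω₂ y₁,
    real_inner_comm Ω₁ y₂]
  ring

namespace Variation

/-- The density of the symplectic form is smooth along smooth variations. -/
theorem continuous_density (f : FramedLoop) {X Y : Variation} (hX : ContDiff ℝ ∞ X.δγ)
    (hX' : Continuous X.δV) (hY : ContDiff ℝ ∞ Y.δγ) (hY' : Continuous Y.δV) :
    Continuous (density f X Y) := by
  have h1 := (contDiff_deriv hX)
  have h2 := (contDiff_deriv hY)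
  have hT := f.contDiff_T
  have hW := f.contDiff_W.continuous
  exact (((hX'.inner hW).mul (h2.inner ℝ hT).continuous).sub
    ((hY'.inner hW).mul (h1.inner ℝ hT).continuous)).add
    ((f.contDiff_speed.continuous.inv₀ fun t => (f.speed_pos t).ne').mul
      (hT.inner ℝ (contDiff_cross h1 h2)).continuous)

theorem density_of_rot {f g : FramedLoop} {X₁ X₂ Y₁ Y₂ : Variation} {A : SO3} {Ω₁ Ω₂ : E3}
    {η₁ η₂ t : ℝ} (hγ : deriv g.γ t = rot A (deriv f.γ t))
    (h₁ : deriv Y₁.δγ t = rot A (deriv X₁.δγ t + cross Ω₁ (deriv f.γ t)))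
    (h₂ : deriv Y₂.δγ t = rot A (deriv X₂.δγ t + cross Ω₂ (deriv f.γ t)))
    (hV₁ : (inner ℝ (Y₁.δV t) (g.W t) : ℝ) =
      inner ℝ (X₁.δV t) (f.W t) + inner ℝ Ω₁ (f.T t) + η₁)
    (hV₂ : (inner ℝ (Y₂.δV t) (g.W t) : ℝ) =
      inner ℝ (X₂.δV t) (f.W t) + inner ℝ Ω₂ (f.T t) + η₂) :
    density g Y₁ Y₂ t = density f X₁ X₂ t + (η₁ * inner ℝ (deriv X₂.δγ t) (f.T t) -
      η₂ * inner ℝ (deriv X₁.δγ t) (f.T t) + (inner ℝ Ω₁ (deriv X₂.δγ t) -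
      inner ℝ Ω₂ (deriv X₁.δγ t) + inner ℝ (cross Ω₁ Ω₂) (deriv f.γ t))) := by
  have hs : g.speed t = f.speed t := by rw [FramedLoop.speed, hγ, norm_rot, FramedLoop.speed]
  have hT : g.T t = rot A (f.T t) := by rw [FramedLoop.T, hs, hγ, FramedLoop.T, map_smul]
  have hv := (f.speed_pos t).ne'
  have hd := f.deriv_γ_eq t
  rw [density, h₁, h₂, hV₁, hV₂, hs, hT, cross_rot, inner_rot, inner_rot, inner_rot, hd,
    inner_cross_add_cross_smul _ _ _ _ _ _ (f.inner_T_T t), density]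
  have h0 : ∀ Ω : E3, inner ℝ (cross Ω (f.speed t • f.T t)) (f.T t) = (0 : ℝ) := fun Ω => by
    rw [cross_smul_right, inner_smul_left, inner_cross_comm, cross_self, inner_zero_right, mul_zero]
  rw [inner_add_left, inner_add_left, h0, h0, inner_smul_right]
  field_simp
  ring

end Variation

/-- The symplectic form does not depend on the lifts of the two paths. -/
theorem sympl_eq_of_equiv {F₁ F₂ G₁ G₂ : ℝ → FramedLoop} (hF₁ : SmoothFamily F₁)
    (hF₂ : SmoothFamily F₂) (hG₁ : SmoothFamily G₁) (hG₂ : SmoothFamily G₂)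
    (h₁ : ∀ ε, F₁ ε ≈ G₁ ε) (h₂ : ∀ ε, F₂ ε ≈ G₂ ε) (hF : F₁ 0 = F₂ 0) (hG : G₁ 0 = G₂ 0) :
    Variation.sympl (G₁ 0) (velocity G₁) (velocity G₂) =
      Variation.sympl (F₁ 0) (velocity F₁) (velocity F₂) := by
  obtain ⟨A, Ω₁, η₁, hA, hy₁, hc₁⟩ := exists_velocity_of_equiv hF₁ hG₁ h₁
  obtain ⟨B, Ω₂, η₂, hB, hy₂, hc₂⟩ := exists_velocity_of_equiv hF₂ hG₂ h₂
  have hi₁ := hF₁.integral_inner_T_eq_zero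
  have hi₂ := hF₂.integral_inner_T_eq_zero
  rw [← hG, ← hF] at hB
  rw [← hF] at hy₂ hc₂ hi₂
  rw [← hG] at hc₂
  have hAB := rot_eq_of_deriv_eq (F₁ 0) fun t => (hA t).symm.trans (hB t)
  simp only [← hAB] at hy₂
  rw [Variation.sympl_eq, Variation.sympl_eq]
  congr 1
  simp only [fun t => Variation.density_of_rot (hA t) (hy₁ t) (hy₂ t) (hc₁ t) (hc₂ t)]
  have c₀ := Variation.continuous_density (F₁ 0) hF₁.velocity_δγ hF₁.velocity_δV.continuous
    hF₂.velocity_δγ hF₂.velocity_δV.continuous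
  have d₁ := contDiff_deriv hF₁.velocity_δγ
  have d₂ := contDiff_deriv hF₂.velocity_δγ
  have hT := (F₁ 0).contDiff_T
  have a₁ := (d₁.inner ℝ hT).continuous
  have a₂ := (d₂.inner ℝ hT).continuous
  have b₁ := ((contDiff_const (c := Ω₂)).inner ℝ d₁).continuous
  have b₂ := ((contDiff_const (c := Ω₁)).inner ℝ d₂).continuous
  have b₃ := ((contDiff_const (c := cross Ω₁ Ω₂)).inner ℝ (F₁ 0).contDiff_deriv_γ).continuous
  have i : ∀ {x : ℝ → ℝ}, Continuous x → IntervalIntegrable x MeasureTheory.volume 0 2 :=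
    fun hx => hx.intervalIntegrable _ _
  rw [intervalIntegral.integral_add (i c₀) (i (by fun_prop)),
    intervalIntegral.integral_add (i (by fun_prop)) (i (by fun_prop)),
    intervalIntegral.integral_sub (i (by fun_prop)) (i (by fun_prop)),
    intervalIntegral.integral_add (i (by fun_prop)) (i (by fun_prop)),
    intervalIntegral.integral_sub (i (by fun_prop)) (i (by fun_prop)),
    intervalIntegral.integral_const_mul, intervalIntegral.integral_const_mul, hi₁, hi₂,
    hF₁.integral_inner_const_eq_zero, hF₂.integral_inner_const_eq_zero,
    (F₁ 0).integral_inner_deriv_γ]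
  ring

theorem existsUnique_omegaValue {c₁ c₂ : ℝ → M} (h₁ : SmoothPath c₁) (h₂ : SmoothPath c₂)
    (h : c₁ 0 = c₂ 0) : ∃! a, OmegaValue c₁ c₂ a := by
  obtain ⟨F₁, hF₁, hc₁⟩ := h₁
  obtain ⟨F₂, hF₂, hc₂, h0⟩ := h₂.exists_lift (h.symm.trans (hc₁ 0))
  refine ⟨_, ⟨F₁, F₂, hF₁, hF₂, hc₁, hc₂, h0.symm, rfl⟩, ?_⟩
  rintro _ ⟨G₁, G₂, hG₁, hG₂, hd₁, hd₂, hG, rfl⟩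
  exact sympl_eq_of_equiv hF₁ hF₂ hG₁ hG₂
    (fun ε => Quotient.exact ((hc₁ ε).symm.trans (hd₁ ε)))
    (fun ε => Quotient.exact ((hc₂ ε).symm.trans (hd₂ ε))) h0.symm hG

/-! ### The basepoint action and its moment map -/

theorem SmoothFamily.shift {F : ℝ → FramedLoop} (hF : SmoothFamily F) {u : ℝ → ℝ}
    (hu : ContDiff ℝ ∞ u) : SmoothFamily fun ε => (F ε).shift (u ε) := by
  have h : ContDiff ℝ ∞ fun p : ℝ × ℝ => (p.1, p.2 + u p.1) :=
    contDiff_fst.prodMk (contDiff_snd.add (hu.comp contDiff_fst))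
  exact ⟨hF.1.comp h, hF.2.comp h⟩

namespace FramedLoop

variable (f : FramedLoop)

theorem shift_zero : f.shift 0 = f :=
  FramedLoop.ext (funext fun t => by simp [shift]) (funext fun t => by simp [shift])

theorem speed_shift (u t : ℝ) : (f.shift u).speed t = f.speed (t + u) := by
  rw [speed, speed, shift, deriv_comp_add_const]

theorem T_shift (u t : ℝ) : (f.shift u).T t = f.T (t + u) := by
  rw [T, T, speed_shift, shift, deriv_comp_add_const]

theorem smoothFamily_shift : SmoothFamily fun ε => f.shift ε :=
  (smoothFamily_const f).shift contDiff_id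

theorem velocity_shift_δγ : (velocity fun ε => f.shift ε).δγ = deriv f.γ := funext fun t => by
  change deriv (fun ε => f.γ (t + ε)) 0 = _
  rw [deriv_comp_const_add, add_zero]

theorem velocity_shift_δV : (velocity fun ε => f.shift ε).δV = deriv f.V := funext fun t => by
  change deriv (fun ε => f.V (t + ε)) 0 = _
  rw [deriv_comp_const_add, add_zero]

theorem deriv_W_shift (t : ℝ) : deriv (fun ε => (f.shift ε).W t) 0 = deriv f.W t := by
  simp only [W_shift]
  rw [deriv_comp_const_add, add_zero]

theorem deriv_speed (t : ℝ) : deriv f.speed t = inner ℝ (deriv (deriv f.γ) t) (f.T t) := by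
  have h := (f.smoothFamily_shift.hasDerivAt_speed t).deriv
  rw [velocity_shift_δγ, shift_zero] at h
  rw [← h]
  simp only [speed_shift]
  rw [deriv_comp_const_add, add_zero]

theorem twistRate_mul_speed (t : ℝ) :
    f.twistRate t * f.speed t = inner ℝ (deriv f.V t) (f.W t) := by
  have hv := (f.speed_pos t).ne'
  rw [twistRate, inner_smul_left, conj_trivial]
  field_simp

theorem weightedTwist_shift (u : ℝ) : (f.shift u).weightedTwist = f.weightedTwist := by
  have hp : Function.Periodic (fun t => f.twistRate t * f.speed t * f.speed t) 2 := fun t => by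
    simp only [twistRate, f.speed_periodic t, f.W_periodic t, deriv_periodic f.periodic_V t]
  have h : ∀ t, (f.shift u).twistRate t = f.twistRate (t + u) := fun t => by
    rw [twistRate, speed_shift, W_shift, shift, deriv_comp_add_const, twistRate]
  simp only [weightedTwist, h, speed_shift]
  rw [intervalIntegral.integral_comp_add_right (fun t => f.twistRate t * f.speed t * f.speed t),
    zero_add, add_comm 2 u, hp.intervalIntegral_add_eq u 0, zero_add]

end FramedLoop

theorem sympl_shift (F₁ F₂ : ℝ → FramedLoop) (u : ℝ) :
    Variation.sympl ((F₁ 0).shift u) (velocity fun ε => (F₁ ε).shift u)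
      (velocity fun ε => (F₂ ε).shift u) =
        Variation.sympl (F₁ 0) (velocity F₁) (velocity F₂) := by
  have hd : ∀ F : ℝ → FramedLoop, ∀ t, deriv (velocity fun ε => (F ε).shift u).δγ t =
      deriv (velocity F).δγ (t + u) := fun F t => deriv_comp_add_const (velocity F).δγ u t
  have hV : ∀ F : ℝ → FramedLoop, ∀ t, (velocity fun ε => (F ε).shift u).δV t =
      (velocity F).δV (t + u) := fun _ _ => rfl
  have hp : Function.Periodic (Variation.density (F₁ 0) (velocity F₁) (velocity F₂)) 2 :=
    fun t => by
      simp only [Variation.density, (F₁ 0).speed_periodic t, (F₁ 0).W_periodic t,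
        (F₁ 0).T_periodic t, velocity_δV_periodic _ t, deriv_periodic (velocity_δγ_periodic _) t]
  rw [Variation.sympl_eq, Variation.sympl_eq]
  congr 1
  have h : ∀ t, Variation.density ((F₁ 0).shift u) (velocity fun ε => (F₁ ε).shift u)
      (velocity fun ε => (F₂ ε).shift u) t =
        Variation.density (F₁ 0) (velocity F₁) (velocity F₂) (t + u) := fun t => by
    simp only [Variation.density, hd, hV, FramedLoop.W_shift, FramedLoop.T_shift,
      FramedLoop.speed_shift]
  simp only [h]
  rw [intervalIntegral.integral_comp_add_right
    (Variation.density (F₁ 0) (velocity F₁) (velocity F₂)), zero_add, add_comm 2 u,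
    hp.intervalIntegral_add_eq u 0, zero_add]

namespace SmoothFamily

variable {F : ℝ → FramedLoop} (hF : SmoothFamily F)
include hF

theorem speed_mul_inner_δV_T (t : ℝ) :
    (F 0).speed t * inner ℝ ((velocity F).δV t) ((F 0).T t) =
      -inner ℝ (deriv (velocity F).δγ t) ((F 0).V t) := by
  have h := (hF.hasDerivAt_deriv_γ t).inner ℝ (hF.hasDerivAt_V t)
  simp only [FramedLoop.normal_V] at h
  have h1 := h.unique (hasDerivAt_const _ _)
  rw [FramedLoop.deriv_γ_eq, inner_smul_left, conj_trivial, real_inner_comm] at h1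
  linarith

theorem speed_mul_inner_δW_T (t : ℝ) :
    (F 0).speed t * inner ℝ (deriv (fun ε => (F ε).W t) 0) ((F 0).T t) =
      -inner ℝ (deriv (velocity F).δγ t) ((F 0).W t) := by
  have h := (hF.hasDerivAt_deriv_γ t).inner ℝ (hF.hasDerivAt_W t)
  have h0 : ∀ ε, inner ℝ (deriv (F ε).γ t) ((F ε).W t) = (0 : ℝ) := fun ε => by
    rw [FramedLoop.deriv_γ_eq, inner_smul_left, FramedLoop.inner_T_W, mul_zero]
  simp only [h0] at h
  have h1 := h.unique (hasDerivAt_const _ _)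
  rw [FramedLoop.deriv_γ_eq, inner_smul_left, conj_trivial, real_inner_comm] at h1
  linarith

end SmoothFamily

namespace FramedLoop

variable (f : FramedLoop)

theorem inner_deriv_V_V (t : ℝ) : (inner ℝ (deriv f.V t) (f.V t) : ℝ) = 0 := by
  simpa only [velocity_shift_δV, shift_zero] using f.smoothFamily_shift.inner_δV_V t

theorem inner_deriv_W_W (t : ℝ) : (inner ℝ (deriv f.W t) (f.W t) : ℝ) = 0 := by
  simpa only [deriv_W_shift, shift_zero] using f.smoothFamily_shift.inner_δW_W t

theorem inner_deriv_W_V (t : ℝ) :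
    (inner ℝ (deriv f.W t) (f.V t) : ℝ) = -inner ℝ (deriv f.V t) (f.W t) := by
  simpa only [velocity_shift_δV, deriv_W_shift, shift_zero] using f.smoothFamily_shift.inner_δW_V t

theorem speed_mul_inner_deriv_V_T (t : ℝ) :
    f.speed t * inner ℝ (deriv f.V t) (f.T t) = -inner ℝ (deriv (deriv f.γ) t) (f.V t) := by
  simpa only [velocity_shift_δV, velocity_shift_δγ, shift_zero] using
    f.smoothFamily_shift.speed_mul_inner_δV_T t

theorem speed_mul_inner_deriv_W_T (t : ℝ) :
    f.speed t * inner ℝ (deriv f.W t) (f.T t) = -inner ℝ (deriv (deriv f.γ) t) (f.W t) := by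
  simpa only [deriv_W_shift, velocity_shift_δγ, shift_zero] using
    f.smoothFamily_shift.speed_mul_inner_δW_T t

end FramedLoop

namespace SmoothFamily

variable {F : ℝ → FramedLoop} (hF : SmoothFamily F)
include hF

/-- The structure equation of the moving frame: the derivative of the twist density `⟨V', W⟩` in
the direction of the family is the derivative of the twist `⟨δV, W⟩` along the curve up to a
curvature term. -/
theorem inner_deriv_V_δW_sub (t : ℝ) :
    (inner ℝ (deriv (F 0).V t) (deriv (fun ε => (F ε).W t) 0) -
      inner ℝ ((velocity F).δV t) (deriv (F 0).W t)) * (F 0).speed t =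
        -(((F 0).speed t)⁻¹ *
          inner ℝ ((F 0).T t) (cross (deriv (velocity F).δγ t) (deriv (deriv (F 0).γ) t))) := by
  have a₁ := hF.speed_mul_inner_δV_T t
  have a₂ := hF.speed_mul_inner_δW_T t
  have b₁ := (F 0).speed_mul_inner_deriv_V_T t
  have b₂ := (F 0).speed_mul_inner_deriv_W_T t
  rw [FramedLoop.inner_T_cross, (F 0).inner_eq_frame_sum t (deriv (F 0).V t),
    (F 0).inner_eq_frame_sum t ((velocity F).δV t), FramedLoop.inner_deriv_V_V,
    FramedLoop.inner_deriv_W_W, hF.inner_δV_V, hF.inner_δW_W]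
  have hv := ((F 0).speed_pos t).ne'
  apply mul_left_cancel₀ hv
  rw [mul_neg, mul_inv_cancel_left₀ hv]
  have e₁ := congrArg₂ (· * ·) b₁ a₂
  have e₂ := congrArg₂ (· * ·) a₁ b₂
  linear_combination e₁ - e₂

/-- The derivative of the moment map along a smooth family is the symplectic pairing with the
generator of the basepoint action. -/
theorem hasDerivAt_weightedTwist :
    HasDerivAt (fun ε => -(Real.pi / 2) * (F ε).weightedTwist)
      (Variation.sympl (F 0) (velocity F) (velocity fun ε => (F 0).shift ε)) 0 := by
  have hμ : ∀ ε, -(Real.pi / 2) * (F ε).weightedTwist = -(1 / 4) *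
      ∫ t in (0 : ℝ)..2, (inner ℝ (deriv (F ε).V t) ((F ε).W t) : ℝ) * (F ε).speed t := fun ε => by
    have := Real.pi_ne_zero
    simp only [FramedLoop.weightedTwist, FramedLoop.twistRate_mul_speed]
    field_simp
    ring
  have hρ : ContDiff ℝ ∞ fun p : ℝ × ℝ =>
      (inner ℝ (deriv (F p.1).V p.2) ((F p.1).W p.2) : ℝ) * (F p.1).speed p.2 :=
    (hF.deriv_V.inner ℝ hF.W).mul hF.speed
  have hD := (hasDerivAt_integral_of_contDiff hρ 0 2 0).const_mul (-(1 / 4))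
  simp only [hμ]
  refine hD.congr_deriv ?_
  -- The boundary term that relates the two densities is a total derivative.
  have hcv : ContDiff ℝ ∞ fun t =>
      (inner ℝ ((velocity F).δV t) ((F 0).W t) : ℝ) * (F 0).speed t :=
    (hF.velocity_δV.inner ℝ (F 0).contDiff_W).mul (F 0).contDiff_speed
  have hpt : ∀ t, deriv (fun ε => (inner ℝ (deriv (F ε).V t) ((F ε).W t) : ℝ) * (F ε).speed t) 0 =
      deriv (fun t => (inner ℝ ((velocity F).δV t) ((F 0).W t) : ℝ) * (F 0).speed t) t -
        Variation.density (F 0) (velocity F) (velocity fun ε => (F 0).shift ε) t := fun t => by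
    have h1 := ((hF.hasDerivAt_deriv_V t).inner ℝ (hF.hasDerivAt_W t)).mul (hF.hasDerivAt_speed t)
    have h2 := ((hasDerivAt_deriv hF.velocity_δV t).inner ℝ
      (hasDerivAt_deriv (F 0).contDiff_W t)).mul (hasDerivAt_deriv (F 0).contDiff_speed t)
    have h3 := hF.inner_deriv_V_δW_sub t
    refine h1.deriv.trans ?_
    have h2' := h2.deriv
    change deriv (fun t => (inner ℝ ((velocity F).δV t) ((F 0).W t) : ℝ) * (F 0).speed t) t = _
      at h2'
    rw [h2', Variation.density, FramedLoop.velocity_shift_δγ, FramedLoop.velocity_shift_δV,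
      (F 0).deriv_speed]
    linear_combination h3
  have hc := Variation.continuous_density (F 0) hF.velocity_δγ hF.velocity_δV.continuous
    (F 0).smoothFamily_shift.velocity_δγ (F 0).smoothFamily_shift.velocity_δV.continuous
  have h0 := integral_deriv_eq_zero hcv (T := 2) fun t => by
    simp only [velocity_δV_periodic F t, (F 0).W_periodic t, (F 0).speed_periodic t]
  rw [Variation.sympl_eq]
  simp only [hpt]
  rw [intervalIntegral.integral_sub ((contDiff_deriv hcv).continuous.intervalIntegrable _ _)
    (hc.intervalIntegrable _ _), h0]
  ring

end SmoothFamily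

theorem isHamiltonianWithMomentMap :
    IsHamiltonianWithMomentMap fun m => -(Real.pi / 2) * weightedTotalTwist m where
  smooth := by
    rintro u c hu ⟨F, hF, hc⟩
    exact ⟨_, hF.shift hu, fun ε => by simp only [hc ε]; rfl⟩
  symplectic := by
    rintro u c₁ c₂ a ⟨F₁, F₂, hF₁, hF₂, hc₁, hc₂, h0, rfl⟩
    induction u using QuotientAddGroup.induction_on with
    | H u => exact ⟨_, _, hF₁.shift (u := fun _ => u) contDiff_const,
        hF₂.shift (u := fun _ => u) contDiff_const, fun ε => by simp only [hc₁ ε]; rfl,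
        fun ε => by simp only [hc₂ ε]; rfl, by rw [h0], sympl_shift F₁ F₂ u⟩
  invariant := by
    intro u m
    induction u using QuotientAddGroup.induction_on with
    | H u => induction m using Quotient.inductionOn with
      | h f => exact congrArg (fun x => -(Real.pi / 2) * x) (f.weightedTwist_shift u)
  moment := by
    rintro c ⟨F, hF, hc⟩
    refine ⟨_, ⟨F, _, hF, (F 0).smoothFamily_shift, hc, fun ε => by rw [hc 0]; rfl,
      (F 0).shift_zero.symm, rfl⟩, ?_⟩
    simp only [hc]
    exact hF.hasDerivAt_weightedTwist

/-! ### Critical points of the weighted total twist -/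

theorem isCriticalPoint_iff_sympl_eq_zero (f : FramedLoop) :
    IsCriticalPoint weightedTotalTwist (toM f) ↔ ∀ F, SmoothFamily F → F 0 = f →
      Variation.sympl f (velocity F) (velocity fun ε => f.shift ε) = 0 := by
  constructor
  · rintro h F hF rfl
    have h1 := (h (fun ε => toM (F ε)) ⟨F, hF, fun _ => rfl⟩ rfl).const_mul (-(Real.pi / 2))
    rw [mul_zero] at h1
    exact hF.hasDerivAt_weightedTwist.unique h1
  · intro h c hc h0
    obtain ⟨F, hF, hcF, rfl⟩ := hc.exists_lift h0
    have h1 := hF.hasDerivAt_weightedTwist.const_mul (-(2 / Real.pi))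
    rw [h F hF rfl, mul_zero] at h1
    refine h1.congr_of_eventuallyEq (.of_forall fun ε => ?_)
    have := Real.pi_ne_zero
    simp only [hcF]
    change (F ε).weightedTwist = _
    field_simp

theorem density_generator (f : FramedLoop) (X : Variation) (t : ℝ) :
    Variation.density f X (velocity fun ε => f.shift ε) t =
      inner ℝ (X.δV t) (f.W t) * deriv f.speed t -
        f.twistRate t * f.speed t * inner ℝ (deriv X.δγ t) (f.T t) +
          (f.speed t)⁻¹ * inner ℝ (f.T t) (cross (deriv X.δγ t) (deriv (deriv f.γ) t)) := by
  rw [Variation.density, f.velocity_shift_δγ, f.velocity_shift_δV, f.twistRate_mul_speed,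
    f.deriv_speed]

/-! ### Frame twists by a variable angle: critical points have unit speed -/

/-- The framed loop with the same base curve and the frame twisted by the periodic angle `φ`. -/
def FramedLoop.twistBy (f : FramedLoop) {φ : ℝ → ℝ} (hφ : ContDiff ℝ ∞ φ)
    (hp : Function.Periodic φ 2) : FramedLoop where
  γ := f.γ
  V t := Real.cos (φ t) • f.V t + Real.sin (φ t) • f.W t
  smooth_γ := f.smooth_γ
  smooth_V := ((Real.contDiff_cos.comp hφ).smul f.smooth_V).add
    ((Real.contDiff_sin.comp hφ).smul f.contDiff_W)
  periodic_γ := f.periodic_γ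
  periodic_V t := by simp only [hp t, f.periodic_V t, f.W_periodic t]
  immersed := f.immersed
  unit_V t := by
    rw [norm_eq_sqrt_real_inner, Real.sqrt_eq_one]
    simp only [inner_add_left, inner_add_right, inner_smul_left, inner_smul_right, conj_trivial,
      inner_V_V, inner_W_W, inner_V_W, inner_W_V]
    linear_combination Real.cos_sq_add_sin_sq (φ t)
  normal_V t := by
    rw [f.deriv_γ_eq, inner_smul_left, inner_add_right, inner_smul_right, inner_smul_right,
      inner_T_V, inner_T_W]
    simp
  length_eq := f.length_eq

theorem speed_eq_one_of_critical {f : FramedLoop}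
    (hf : IsCriticalPoint weightedTotalTwist (toM f)) (t : ℝ) : f.speed t = 1 := by
  have hφ : ContDiff ℝ ∞ (deriv f.speed) := contDiff_deriv f.contDiff_speed
  have hp := deriv_periodic f.speed_periodic
  have hε : ∀ ε : ℝ, ContDiff ℝ ∞ fun t => ε * deriv f.speed t := fun ε =>
    contDiff_const.mul hφ
  let F : ℝ → FramedLoop := fun ε => f.twistBy (hε ε) fun t => by simp only [hp t]
  have hA : ContDiff ℝ ∞ fun p : ℝ × ℝ => p.1 * deriv f.speed p.2 :=
    contDiff_fst.mul (hφ.comp contDiff_snd)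
  have hF : SmoothFamily F := ⟨f.smooth_γ.comp contDiff_snd,
    ((Real.contDiff_cos.comp hA).smul (f.smooth_V.comp contDiff_snd)).add
      ((Real.contDiff_sin.comp hA).smul (f.contDiff_W.comp contDiff_snd))⟩
  have hF0 : F 0 = f := FramedLoop.ext rfl (funext fun t => by simp [F, FramedLoop.twistBy])
  have hγ : (velocity F).δγ = fun _ => 0 := funext fun t => by
    change deriv (fun _ : ℝ => f.γ t) 0 = 0
    rw [deriv_const]
  have hV : ∀ t, (velocity F).δV t = deriv f.speed t • f.W t := fun t => by
    have h0 : HasDerivAt (fun ε : ℝ => ε * deriv f.speed t) (deriv f.speed t) 0 := by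
      simpa using (hasDerivAt_id (0 : ℝ)).mul_const (deriv f.speed t)
    have h1 := (h0.cos.smul_const (f.V t)).add (h0.sin.smul_const (f.W t))
    refine h1.deriv.trans ?_
    simp
  have h := (isCriticalPoint_iff_sympl_eq_zero f).1 hf F hF hF0
  have hd : ∀ t, Variation.density f (velocity F) (velocity fun ε => f.shift ε) t =
      deriv f.speed t * deriv f.speed t := fun t => by
    rw [density_generator, hV, hγ, inner_smul_left, f.inner_W_W]
    simp [cross]
  rw [Variation.sympl_eq] at h
  simp only [hd] at h
  have h2 : ∀ t, deriv f.speed t = 0 := fun t => mul_self_eq_zero.1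
    (eq_zero_of_integral_eq_zero (hφ.mul hφ).continuous (fun t => mul_self_nonneg _) two_pos
      (fun t => by simp only [hp t]) (by linarith) t)
  have h3 : ∀ s, f.speed s = f.speed t := fun s =>
    is_const_of_deriv_eq_zero (f.contDiff_speed.differentiable (by simp)) h2 s t
  have h4 : ∫ s in (0 : ℝ)..2, f.speed s = 2 := f.length_eq
  simp only [h3] at h4
  rw [intervalIntegral.integral_const] at h4
  simp only [sub_zero, smul_eq_mul] at h4
  linarith

/-! ### Deformations of the base curve -/

theorem integral_norm_pos {x : ℝ → E3} (hx : Continuous x) (h : ∀ t, x t ≠ 0) :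
    0 < ∫ t in (0 : ℝ)..2, ‖x t‖ :=
  intervalIntegral.intervalIntegral_pos_of_pos (hx.norm.intervalIntegrable _ _)
    (fun t => norm_pos_iff.2 (h t)) two_pos

namespace FramedLoop

variable (f : FramedLoop)

/-- The (unnormalized) component of the framing `V` orthogonal to `y`. -/
def normalPart (y : E3) (t : ℝ) : E3 :=
  (inner ℝ y y : ℝ) • f.V t - (inner ℝ (f.V t) y : ℝ) • y

theorem ne_zero_of_inner_T_pos {y : E3} {t : ℝ} (h : 0 < (inner ℝ y (f.T t) : ℝ)) : y ≠ 0 := by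
  rintro rfl
  simp at h

theorem normalPart_ne_zero {y : E3} {t : ℝ} (h : 0 < (inner ℝ y (f.T t) : ℝ)) :
    f.normalPart y t ≠ 0 := by
  intro h0
  have hy : (inner ℝ y y : ℝ) ≠ 0 := inner_self_ne_zero.2 (f.ne_zero_of_inner_T_pos h)
  have hT := congrArg (fun x => (inner ℝ x (f.T t) : ℝ)) h0
  have hV := congrArg (fun x => (inner ℝ x (f.V t) : ℝ)) h0
  simp only [normalPart, inner_sub_left, inner_smul_left, conj_trivial, inner_V_T, inner_V_V,
    inner_zero_left, mul_zero, zero_sub, mul_one] at hT hV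
  have h1 : (inner ℝ (f.V t) y : ℝ) = 0 := by
    rcases mul_eq_zero.1 (neg_eq_zero.1 hT) with h1 | h1
    · exact h1
    · exact absurd h1 h.ne'
  rw [h1] at hV
  exact hy (by linarith)

/-- The closed curve `x`, rescaled to length 2 and framed by the normal projection of the framing
of `f`. The hypothesis `h` makes `x` immersed and nowhere tangent to that framing. -/
def deform (x : ℝ → E3) (hx : ContDiff ℝ ∞ x) (hp : Function.Periodic x 2)
    (h : ∀ t, 0 < (inner ℝ (deriv x t) (f.T t) : ℝ)) : FramedLoop where
  γ t := (2 / ∫ s in (0 : ℝ)..2, ‖deriv x s‖) • x t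
  V t := ‖f.normalPart (deriv x t) t‖⁻¹ • f.normalPart (deriv x t) t
  smooth_γ := hx.const_smul _
  smooth_V := by
    have h1 : ContDiff ℝ ∞ fun t => f.normalPart (deriv x t) t :=
      (((contDiff_deriv hx).inner ℝ (contDiff_deriv hx)).smul f.smooth_V).sub
        ((f.smooth_V.inner ℝ (contDiff_deriv hx)).smul (contDiff_deriv hx))
    have h2 := fun t => f.normalPart_ne_zero (h t)
    exact ((h1.norm ℝ h2).inv fun t => norm_ne_zero_iff.2 (h2 t)).smul h1
  periodic_γ t := by simp only [hp t]
  periodic_V t := by simp only [normalPart, deriv_periodic hp t, f.periodic_V t]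
  immersed t := by
    have hL := integral_norm_pos (contDiff_deriv hx).continuous
      fun t => f.ne_zero_of_inner_T_pos (h t)
    rw [((hasDerivAt_deriv hx t).fun_const_smul _).deriv]
    exact smul_ne_zero (by positivity) (f.ne_zero_of_inner_T_pos (h t))
  unit_V t := by
    rw [norm_smul, norm_inv, norm_norm,
      inv_mul_cancel₀ (norm_ne_zero_iff.2 (f.normalPart_ne_zero (h t)))]
  normal_V t := by
    rw [((hasDerivAt_deriv hx t).fun_const_smul _).deriv, inner_smul_left, inner_smul_right,
      normalPart, inner_sub_right, inner_smul_right, inner_smul_right,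
      real_inner_comm (deriv x t) (f.V t)]
    ring
  length_eq := by
    have hL := integral_norm_pos (contDiff_deriv hx).continuous
      fun t => f.ne_zero_of_inner_T_pos (h t)
    simp only [fun t => ((hasDerivAt_deriv hx t).fun_const_smul
      (2 / ∫ s in (0 : ℝ)..2, ‖deriv x s‖)).deriv, norm_smul]
    rw [intervalIntegral.integral_const_mul, Real.norm_of_nonneg (by positivity)]
    field_simp

/-- Every small vector field along the base curve is, up to a dilation, the velocity of a smooth
family of framed loops. -/
theorem exists_family {X : ℝ → E3} (hX : ContDiff ℝ ∞ X) (hp : Function.Periodic X 2)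
    (h : ∀ t, |(inner ℝ (deriv X t) (f.T t) : ℝ)| < f.speed t) :
    ∃ F : ℝ → FramedLoop, SmoothFamily F ∧ F 0 = f ∧
      ∃ l : ℝ, ∀ t, (velocity F).δγ t = X t + l • f.γ t := by
  -- The bounded parameter `sin ε` keeps the curves immersed for all `ε`.
  have hG : ContDiff ℝ ∞ fun p : ℝ × ℝ => f.γ p.2 + Real.sin p.1 • X p.2 :=
    (f.smooth_γ.comp contDiff_snd).add
      ((Real.contDiff_sin.comp contDiff_fst).smul (hX.comp contDiff_snd))
  have hd : ∀ ε t, deriv (fun t => f.γ t + Real.sin ε • X t) t =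
      deriv f.γ t + Real.sin ε • deriv X t := fun ε t =>
    ((hasDerivAt_deriv f.smooth_γ t).fun_add ((hasDerivAt_deriv hX t).fun_const_smul _)).deriv
  have hpos : ∀ ε t, 0 < (inner ℝ (deriv (fun t => f.γ t + Real.sin ε • X t) t) (f.T t) : ℝ) :=
    fun ε t => by
      rw [hd, inner_add_left, inner_smul_left, f.deriv_γ_eq, inner_smul_left, f.inner_T_T,
        conj_trivial, conj_trivial, mul_one]
      have h1 : |Real.sin ε * inner ℝ (deriv X t) (f.T t)| ≤ |inner ℝ (deriv X t) (f.T t)| := by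
        rw [abs_mul]
        exact mul_le_of_le_one_left (abs_nonneg _) (Real.abs_sin_le_one ε)
      have h2 := neg_abs_le (Real.sin ε * inner ℝ (deriv X t) (f.T t))
      have h3 := h t
      linarith
  let F : ℝ → FramedLoop := fun ε => f.deform (fun t => f.γ t + Real.sin ε • X t)
    (contDiff_slice_snd hG ε) (fun t => by simp only [f.periodic_γ t, hp t]) (hpos ε)
  have hG' := contDiff_deriv_snd hG
  have hne := fun p : ℝ × ℝ => f.ne_zero_of_inner_T_pos (hpos p.1 p.2)
  have hL : ContDiff ℝ ∞ fun ε => 2 / ∫ t in (0 : ℝ)..2,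
      ‖deriv (fun t => f.γ t + Real.sin ε • X t) t‖ :=
    contDiff_const.div (contDiff_integral (hG'.norm ℝ hne) 0 2) fun ε =>
      (integral_norm_pos (contDiff_slice_snd hG' ε).continuous fun t => hne (ε, t)).ne'
  have hV := f.smooth_V.comp (contDiff_snd (E := ℝ) (F := ℝ) (𝕜 := ℝ))
  have hN : ContDiff ℝ ∞ fun p : ℝ × ℝ =>
      f.normalPart (deriv (fun t => f.γ t + Real.sin p.1 • X t) p.2) p.2 :=
    ((hG'.inner ℝ hG').smul hV).sub ((hV.inner ℝ hG').smul hG')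
  have hN0 := fun p : ℝ × ℝ => f.normalPart_ne_zero (hpos p.1 p.2)
  have hL0 : (2 / ∫ t in (0 : ℝ)..2, ‖deriv (fun t => f.γ t + Real.sin 0 • X t) t‖) = 1 := by
    simp only [Real.sin_zero, zero_smul, add_zero]
    have := f.length_eq
    rw [this]
    norm_num
  refine ⟨F, ⟨(hL.comp contDiff_fst).smul hG,
    ((hN.norm ℝ hN0).inv fun p => norm_ne_zero_iff.2 (hN0 p)).smul hN⟩,
    FramedLoop.ext (funext fun t => ?_) (funext fun t => ?_), deriv (fun ε =>
      2 / ∫ t in (0 : ℝ)..2, ‖deriv (fun t => f.γ t + Real.sin ε • X t) t‖) 0, fun t => ?_⟩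
  · change (2 / ∫ t in (0 : ℝ)..2, ‖deriv (fun t => f.γ t + Real.sin 0 • X t) t‖) • _ = _
    rw [hL0]
    simp
  · have h1 : f.normalPart (deriv (fun t => f.γ t + Real.sin 0 • X t) t) t =
        (inner ℝ (deriv f.γ t) (deriv f.γ t) : ℝ) • f.V t := by
      rw [hd, normalPart, Real.sin_zero, zero_smul, add_zero,
        real_inner_comm (deriv f.γ t) (f.V t), f.normal_V, zero_smul, sub_zero]
    have h2 : 0 < (inner ℝ (deriv f.γ t) (deriv f.γ t) : ℝ) :=
      real_inner_self_pos.2 (f.immersed t)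
    change ‖f.normalPart (deriv (fun t => f.γ t + Real.sin 0 • X t) t) t‖⁻¹ •
      f.normalPart (deriv (fun t => f.γ t + Real.sin 0 • X t) t) t = _
    rw [h1, norm_smul, f.unit_V, mul_one, Real.norm_of_nonneg h2.le, inv_smul_smul₀ h2.ne']
  · have h1 : HasDerivAt (fun ε => f.γ t + Real.sin ε • X t) (X t) 0 := by
      simpa using ((Real.hasDerivAt_sin 0).smul_const (X t)).const_add (f.γ t)
    have h2 := (hasDerivAt_deriv hL 0).smul h1
    refine h2.deriv.trans ?_
    rw [hL0, one_smul, Real.sin_zero, zero_smul, add_zero]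

end FramedLoop

/-! ### Critical points are covered circles with constant twist rate -/

namespace FramedLoop

variable {f : FramedLoop} (h1 : ∀ t, f.speed t = 1)
include h1

theorem T_eq_deriv (t : ℝ) : f.T t = deriv f.γ t := by rw [T, h1, inv_one, one_smul]

theorem inner_deriv_γ_self (t : ℝ) : (inner ℝ (deriv f.γ t) (deriv f.γ t) : ℝ) = 1 := by
  rw [← T_eq_deriv h1, inner_T_T]

theorem inner_deriv_deriv_γ (t : ℝ) : (inner ℝ (deriv (deriv f.γ) t) (deriv f.γ t) : ℝ) = 0 := by
  rw [← T_eq_deriv h1, ← deriv_speed, funext h1, deriv_const]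

theorem twistRate_eq_inner (t : ℝ) : f.twistRate t = inner ℝ (deriv f.V t) (f.W t) := by
  rw [← twistRate_mul_speed, h1, mul_one]

theorem density_generator_of_speed_eq_one (X : Variation) (t : ℝ) :
    Variation.density f X (velocity fun ε => f.shift ε) t =
      inner ℝ (deriv X.δγ t) (cross (deriv (deriv f.γ) t) (deriv f.γ t)) -
        f.twistRate t * inner ℝ (deriv X.δγ t) (deriv f.γ t) := by
  rw [density_generator, h1, T_eq_deriv h1, funext h1, deriv_const,
    real_inner_comm (cross (deriv X.δγ t) (deriv (deriv f.γ) t)), inner_cross_comm]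
  ring

theorem contDiff_twistRate : ContDiff ℝ ∞ f.twistRate := by
  rw [funext (twistRate_eq_inner h1)]
  exact (contDiff_deriv f.smooth_V).inner ℝ f.contDiff_W

/-- For a unit speed loop, the pairing of a velocity with the generator of the basepoint action is
the `L²` pairing of `d/dt δγ` with `(τ - tw) T + T' × T`. The constant `τ` is arbitrary because the
families preserve the length. -/
theorem integral_density_generator {F : ℝ → FramedLoop} (hF : SmoothFamily F) (hF0 : F 0 = f)
    (τ : ℝ) : ∫ t in (0 : ℝ)..2,
      Variation.density f (velocity F) (velocity fun ε => f.shift ε) t =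
    ∫ t in (0 : ℝ)..2, (inner ℝ (deriv (velocity F).δγ t)
      ((τ - f.twistRate t) • deriv f.γ t + cross (deriv (deriv f.γ) t) (deriv f.γ t)) : ℝ) := by
  have hy := contDiff_deriv hF.velocity_δγ
  have h2 := hF.integral_inner_T_eq_zero
  rw [hF0] at h2
  simp only [T_eq_deriv h1] at h2
  have hc := Variation.continuous_density f hF.velocity_δγ hF.velocity_δV.continuous
    f.smoothFamily_shift.velocity_δγ f.smoothFamily_shift.velocity_δV.continuous
  have hpt : ∀ t, (inner ℝ (deriv (velocity F).δγ t)
      ((τ - f.twistRate t) • deriv f.γ t + cross (deriv (deriv f.γ) t) (deriv f.γ t)) : ℝ) =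
      Variation.density f (velocity F) (velocity fun ε => f.shift ε) t +
        τ * inner ℝ (deriv (velocity F).δγ t) (deriv f.γ t) := fun t => by
    rw [density_generator_of_speed_eq_one h1, inner_add_right, inner_smul_right]
    ring
  simp only [hpt]
  rw [intervalIntegral.integral_add (hc.intervalIntegrable _ _)
    (((hy.inner ℝ f.contDiff_deriv_γ).continuous.const_mul τ).intervalIntegrable _ _),
    intervalIntegral.integral_const_mul, h2, mul_zero, add_zero]

end FramedLoop

/-- The Euler-Lagrange equation of the weighted total twist: at a critical point the vector field
`(τ - tw) T + T' × T` is constant, where `τ` is the mean twist rate. -/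
theorem deriv_eq_zero_of_critical {f : FramedLoop}
    (hf : IsCriticalPoint weightedTotalTwist (toM f)) : ∃ τ : ℝ,
      ∫ t in (0 : ℝ)..2, (τ - f.twistRate t) = 0 ∧ ∀ t, deriv (fun t =>
        (τ - f.twistRate t) • deriv f.γ t + cross (deriv (deriv f.γ) t) (deriv f.γ t)) t = 0 := by
  have h1 := speed_eq_one_of_critical hf
  have hr := FramedLoop.contDiff_twistRate h1
  have hγ := f.contDiff_deriv_γ
  have hγp := deriv_periodic f.periodic_γ
  set τ : ℝ := 1 / 2 * ∫ t in (0 : ℝ)..2, f.twistRate t with hτ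
  set U : ℝ → E3 := fun t =>
    (τ - f.twistRate t) • deriv f.γ t + cross (deriv (deriv f.γ) t) (deriv f.γ t) with hU
  have hUs : ContDiff ℝ ∞ U :=
    ((contDiff_const.sub hr).smul hγ).add (contDiff_cross (contDiff_deriv hγ) hγ)
  have hUp : Function.Periodic U 2 := fun t => by
    simp only [hU, FramedLoop.twistRate, f.speed_periodic t, deriv_periodic f.periodic_V t,
      f.W_periodic t, hγp t, deriv_periodic hγp t]
  have hUs' := contDiff_deriv hUs
  have hUp' := deriv_periodic hUp
  have hUs'' := contDiff_deriv hUs'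
  have hUp'' := deriv_periodic hUp'
  have i : ∀ {x : ℝ → ℝ}, Continuous x → IntervalIntegrable x MeasureTheory.volume 0 2 :=
    fun hx => hx.intervalIntegrable _ _
  have h3 : ∫ t in (0 : ℝ)..2, (τ - f.twistRate t) = 0 := by
    rw [intervalIntegral.integral_sub (i continuous_const) (i hr.continuous),
      intervalIntegral.integral_const, hτ]
    simp
  refine ⟨τ, h3, ?_⟩
  -- The variation is a small multiple of `U'`.
  obtain ⟨C, hC⟩ := (hUp''.isBounded_of_continuous two_ne_zero hUs''.continuous).exists_norm_le
  have hC0 : 0 ≤ C := (norm_nonneg _).trans (hC _ ⟨0, rfl⟩)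
  set k : ℝ := (C + 1)⁻¹ with hk
  have hk0 : 0 < k := by positivity
  have hXd : ∀ t, deriv (fun t => k • deriv U t) t = k • deriv (deriv U) t := fun t =>
    ((hasDerivAt_deriv hUs' t).fun_const_smul k).deriv
  obtain ⟨F, hF, hF0, l, hl⟩ := f.exists_family (X := fun t => k • deriv U t)
    (hUs'.const_smul k) (fun t => by simp only [hUp' t]) fun t => by
      rw [hXd, h1, inner_smul_left, conj_trivial, abs_mul, abs_of_pos hk0]
      have h2 : |(inner ℝ (deriv (deriv U) t) (f.T t) : ℝ)| ≤ C := by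
        refine (abs_real_inner_le_norm _ _).trans ?_
        rw [norm_eq_sqrt_real_inner (f.T t), f.inner_T_T, Real.sqrt_one, mul_one]
        exact hC _ ⟨t, rfl⟩
      rw [hk, inv_mul_lt_iff₀ (by positivity)]
      linarith
  have h2 := (isCriticalPoint_iff_sympl_eq_zero f).1 hf F hF hF0
  rw [Variation.sympl_eq, FramedLoop.integral_density_generator h1 hF hF0 τ] at h2
  have hy : ∀ t, deriv (velocity F).δγ t = k • deriv (deriv U) t + l • deriv f.γ t := fun t => by
    rw [funext hl, ← hXd]
    exact ((hasDerivAt_deriv (hUs'.const_smul k) t).fun_add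
      ((hasDerivAt_deriv f.smooth_γ t).fun_const_smul l)).deriv
  have hUU : ∀ t, HasDerivAt (fun t => (inner ℝ (deriv U t) (U t) : ℝ))
      (inner ℝ (deriv U t) (deriv U t) + inner ℝ (deriv (deriv U) t) (U t)) t := fun t =>
    (hasDerivAt_deriv hUs' t).inner ℝ (hasDerivAt_deriv hUs t)
  have hγU : ∀ t, (inner ℝ (deriv f.γ t) (U t) : ℝ) = τ - f.twistRate t := fun t => by
    rw [hU, inner_add_right, inner_smul_right, FramedLoop.inner_deriv_γ_self h1,
      inner_cross_right]
    ring
  have hpt : ∀ t, (inner ℝ (deriv (velocity F).δγ t) (U t) : ℝ) =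
      k * (deriv (fun t => (inner ℝ (deriv U t) (U t) : ℝ)) t -
        inner ℝ (deriv U t) (deriv U t)) + l * (τ - f.twistRate t) := fun t => by
    rw [hy, inner_add_left, inner_smul_left, inner_smul_left, hγU, (hUU t).deriv, conj_trivial,
      conj_trivial]
    ring
  have hUUs : ContDiff ℝ ∞ fun t => (inner ℝ (deriv U t) (U t) : ℝ) := hUs'.inner ℝ hUs
  have hUU' := (hUs'.inner ℝ hUs').continuous
  change 1 / 4 * ∫ t in (0 : ℝ)..2, (inner ℝ (deriv (velocity F).δγ t) (U t) : ℝ) = 0 at h2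
  simp only [hpt] at h2
  have hUUc := (contDiff_deriv hUUs).continuous
  have hrc := hr.continuous
  rw [intervalIntegral.integral_add (i (by fun_prop)) (i (by fun_prop)),
    intervalIntegral.integral_const_mul, intervalIntegral.integral_const_mul, h3,
    intervalIntegral.integral_sub (i hUUc) (i hUU'),
    integral_deriv_eq_zero hUUs fun t => by simp only [hUp t, hUp' t]] at h2
  have h4 : ∫ t in (0 : ℝ)..2, (inner ℝ (deriv U t) (deriv U t) : ℝ) = 0 := by
    have : k * (∫ t in (0 : ℝ)..2, (inner ℝ (deriv U t) (deriv U t) : ℝ)) = 0 := by linarith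
    exact (mul_eq_zero.1 this).resolve_left hk0.ne'
  exact fun t => inner_self_eq_zero.1 (eq_zero_of_integral_eq_zero hUU'
    (fun t => real_inner_self_nonneg) two_pos (fun t => by simp only [hUp' t]) h4 t)

/-- A unit speed closed curve with constant binormal `T' × T` is a covered round circle. -/
theorem exists_isCoveredCircle {f : FramedLoop} (h1 : ∀ t, f.speed t = 1) {B : E3}
    (hB : ∀ t, cross (deriv (deriv f.γ) t) (deriv f.γ t) = B) :
    ∃ h : ℕ, 0 < h ∧ IsCoveredCircle h f.γ := by
  have hTT := FramedLoop.inner_deriv_γ_self h1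
  have hNT := FramedLoop.inner_deriv_deriv_γ h1
  have hs := f.contDiff_deriv_γ
  have hs' := contDiff_deriv hs
  have hTB : ∀ t, (inner ℝ (deriv f.γ t) B : ℝ) = 0 := fun t => by
    rw [← hB t, inner_cross_right]
  have hN : ∀ t, deriv (deriv f.γ) t = cross (deriv f.γ t) B := fun t => by
    rw [← hB t, cross_cross_left, hTT, real_inner_comm, hNT]
    simp
  -- `κ = ‖B‖` is the curvature.
  set κ : ℝ := ‖B‖ with hκ
  have hNN : ∀ t, (inner ℝ (deriv (deriv f.γ) t) (deriv (deriv f.γ) t) : ℝ) = κ ^ 2 := fun t => by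
    rw [hN, inner_cross_cross, hTT, hTB, real_inner_self_eq_norm_sq, hκ]
    ring
  have hN' : ∀ t, HasDerivAt (deriv (deriv f.γ)) (-(κ ^ 2) • deriv f.γ t) t := fun t => by
    have h2 := hasDerivAt_cross (hasDerivAt_deriv hs t) (hasDerivAt_const t B)
    rw [← funext hN, hN, cross_swap (cross _ _), cross_cross_left,
      real_inner_comm (deriv f.γ t) B, hTB, real_inner_self_eq_norm_sq] at h2
    convert h2 using 1
    have h0 : cross (deriv f.γ t) 0 = 0 := by simp [cross]
    rw [h0]
    module
  have hκ0 : 0 < κ := by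
    refine (norm_nonneg B).lt_of_ne' fun h0 => ?_
    have h2 : ∀ t, deriv (deriv f.γ) t = 0 := fun t => by
      have h3 := hNN t
      rw [hκ, h0] at h3
      exact inner_self_eq_zero.1 (h3.trans (by norm_num))
    have h3 : ∀ t, deriv f.γ t = deriv f.γ 0 := fun t =>
      is_const_of_deriv_eq_zero (hs.differentiable (by simp)) h2 t 0
    have h4 := integral_deriv_eq_zero f.smooth_γ f.periodic_γ
    simp only [h3] at h4
    rw [intervalIntegral.integral_const] at h4
    exact f.immersed 0 ((smul_eq_zero.1 h4).resolve_left (by norm_num))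
  have hcos := hasDerivAt_cos_mul κ
  have hsin := hasDerivAt_sin_mul κ
  -- In the frame rotating with angular velocity `κ`, the tangent and the normal are constant.
  have hC : ∀ t, Real.cos (κ * t) • deriv f.γ t - (κ⁻¹ * Real.sin (κ * t)) • deriv (deriv f.γ) t =
      deriv f.γ 0 := fun t => by
    have hd : ∀ t, HasDerivAt (fun t => Real.cos (κ * t) • deriv f.γ t -
        (κ⁻¹ * Real.sin (κ * t)) • deriv (deriv f.γ) t) 0 t := fun t => by
      refine (((hcos t).smul (hasDerivAt_deriv hs t)).sub
        (((hsin t).const_mul κ⁻¹).smul (hN' t))).congr_deriv ?_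
      have h3 : κ⁻¹ * (Real.cos (κ * t) * κ) = Real.cos (κ * t) := by field_simp
      have h4 : κ⁻¹ * Real.sin (κ * t) * κ ^ 2 = Real.sin (κ * t) * κ := by field_simp
      rw [h3, smul_smul, mul_neg, h4]
      module
    have h3 := is_const_of_deriv_eq_zero (fun t => (hd t).differentiableAt)
      (fun t => (hd t).deriv) t 0
    simpa using h3
  have hD : ∀ t, Real.sin (κ * t) • deriv f.γ t + (κ⁻¹ * Real.cos (κ * t)) • deriv (deriv f.γ) t =
      κ⁻¹ • deriv (deriv f.γ) 0 := fun t => by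
    have hd : ∀ t, HasDerivAt (fun t => Real.sin (κ * t) • deriv f.γ t +
        (κ⁻¹ * Real.cos (κ * t)) • deriv (deriv f.γ) t) 0 t := fun t => by
      refine (((hsin t).smul (hasDerivAt_deriv hs t)).add
        (((hcos t).const_mul κ⁻¹).smul (hN' t))).congr_deriv ?_
      have h3 : κ⁻¹ * (-Real.sin (κ * t) * κ) = -Real.sin (κ * t) := by field_simp
      have h4 : κ⁻¹ * Real.cos (κ * t) * κ ^ 2 = Real.cos (κ * t) * κ := by field_simp
      rw [h3, smul_smul, mul_neg, h4]
      module
    have h3 := is_const_of_deriv_eq_zero (fun t => (hd t).differentiableAt)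
      (fun t => (hd t).deriv) t 0
    simpa using h3
  have hγ' : ∀ t, deriv f.γ t = Real.cos (κ * t) • deriv f.γ 0 +
      Real.sin (κ * t) • κ⁻¹ • deriv (deriv f.γ) 0 := fun t => by
    rw [← hC t, ← hD t]
    calc deriv f.γ t = (Real.cos (κ * t) ^ 2 + Real.sin (κ * t) ^ 2) • deriv f.γ t := by
          rw [Real.cos_sq_add_sin_sq, one_smul]
      _ = _ := by module
  obtain ⟨n, hn⟩ : ∃ n : ℤ, (n : ℝ) * (2 * Real.pi) = κ * 2 := by
    rw [← Real.cos_eq_one_iff]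
    have h3 := hγ' 2
    have h4 := deriv_periodic f.periodic_γ 0
    rw [zero_add] at h4
    have h5 := congrArg (fun x => (inner ℝ x (deriv f.γ 0) : ℝ)) (h4.symm.trans h3)
    simp only [inner_add_left, inner_smul_left, hTT, hNT, conj_trivial] at h5
    linarith
  have hκn : κ = n * Real.pi := by linarith
  have hn0 : 0 < n := by
    have : 0 < (n : ℝ) := by
      rw [hκn] at hκ0
      exact pos_of_mul_pos_left hκ0 Real.pi_pos.le
    exact_mod_cast this
  lift n to ℕ using hn0.le
  have hn0' : 0 < n := by exact_mod_cast hn0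
  rw [Int.cast_natCast] at hκn
  refine ⟨n, hn0', h1, f.γ 0 + κ⁻¹ • κ⁻¹ • deriv (deriv f.γ) 0, -κ⁻¹ • deriv (deriv f.γ) 0,
    deriv f.γ 0, κ⁻¹, inv_pos.2 hκ0, ?_, h1 0, ?_, fun t => ?_⟩
  · rw [norm_smul, norm_neg, norm_inv, Real.norm_of_nonneg hκ0.le, norm_eq_sqrt_real_inner, hNN,
      Real.sqrt_sq hκ0.le, inv_mul_cancel₀ hκ0.ne']
  · rw [inner_smul_left, hNT, mul_zero]
  · rw [← hκn]
    have hd : ∀ t, HasDerivAt (fun t => f.γ t - κ⁻¹ • (Real.cos (κ * t) •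
        (-κ⁻¹ • deriv (deriv f.γ) 0) + Real.sin (κ * t) • deriv f.γ 0)) 0 t := fun t => by
      refine ((hasDerivAt_deriv f.smooth_γ t).sub ((((hcos t).smul_const _).add
        ((hsin t).smul_const _)).const_smul κ⁻¹)).congr_deriv ?_
      rw [hγ' t, sub_eq_zero, smul_add, smul_smul κ⁻¹, smul_smul κ⁻¹]
      have h3 : κ⁻¹ * (-Real.sin (κ * t) * κ) = -Real.sin (κ * t) := by field_simp
      have h4 : κ⁻¹ * (Real.cos (κ * t) * κ) = Real.cos (κ * t) := by field_simp
      rw [h3, h4]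
      module
    have h3 := is_const_of_deriv_eq_zero (fun t => (hd t).differentiableAt)
      (fun t => (hd t).deriv) t 0
    rw [sub_eq_iff_eq_add] at h3
    rw [h3]
    simp only [mul_zero, Real.cos_zero, Real.sin_zero]
    module

/-- The unit speed condition forces the radius `1 / (h π)` of a covered circle. -/
theorem IsCoveredCircle.exists_deriv_eq {h : ℕ} {γ : ℝ → E3} (hh : 0 < h)
    (hγ : IsCoveredCircle h γ) : ∃ p e₁ e₂ : E3, ‖e₁‖ = 1 ∧ ‖e₂‖ = 1 ∧ inner ℝ e₁ e₂ = (0 : ℝ) ∧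
      (∀ t, γ t = p + (h * Real.pi)⁻¹ • (Real.cos (h * Real.pi * t) • e₁ +
        Real.sin (h * Real.pi * t) • e₂)) ∧
      (∀ t, deriv γ t = -Real.sin (h * Real.pi * t) • e₁ + Real.cos (h * Real.pi * t) • e₂) ∧
      ∀ t, deriv (deriv γ) t = -(h * Real.pi) • (Real.cos (h * Real.pi * t) • e₁ +
        Real.sin (h * Real.pi * t) • e₂) := by
  obtain ⟨h1, p, e₁, e₂, R, hR, he₁, he₂, he, hγ⟩ := hγ
  have hκ0 : 0 < h * Real.pi := by positivity
  set κ := h * Real.pi with hκ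
  have hcos := hasDerivAt_cos_mul κ
  have hsin := hasDerivAt_sin_mul κ
  have hd : ∀ t, deriv γ t =
      (R * κ) • (-Real.sin (κ * t) • e₁ + Real.cos (κ * t) • e₂) := fun t => by
    rw [funext hγ]
    refine (((((hcos t).smul_const e₁).add ((hsin t).smul_const e₂)).const_smul
      R).const_add p).deriv.trans ?_
    module
  -- The radius is determined by the unit speed condition.
  have hRκ : R * κ = 1 := by
    have h2 := h1 0
    rw [hd, norm_smul, mul_zero, Real.sin_zero, Real.cos_zero] at h2
    simpa [he₂, abs_of_pos hR, abs_of_pos hκ0] using h2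
  rw [eq_inv_of_mul_eq_one_left hRκ] at hγ
  simp only [hRκ, one_smul] at hd
  refine ⟨p, e₁, e₂, he₁, he₂, he, hγ, hd, fun t => ?_⟩
  rw [funext hd]
  refine (((hsin t).neg.smul_const e₁).add ((hcos t).smul_const e₂)).deriv.trans ?_
  module

theorem isCriticalPoint_iff (f : FramedLoop) : IsCriticalPoint weightedTotalTwist (toM f) ↔
    (∃ h : ℕ, 0 < h ∧ IsCoveredCircle h f.γ) ∧ ∃ τ : ℝ, ∀ t, f.twistRate t = τ := by
  constructor
  · intro hf
    have h1 := speed_eq_one_of_critical hf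
    have hr := FramedLoop.contDiff_twistRate h1
    have hs := f.contDiff_deriv_γ
    have hs' := contDiff_deriv hs
    obtain ⟨τ, hτ0, hτ⟩ := deriv_eq_zero_of_critical hf
    have hU : ∀ t, HasDerivAt (fun t => (τ - f.twistRate t) • deriv f.γ t +
        cross (deriv (deriv f.γ) t) (deriv f.γ t)) _ t := fun t =>
      (((hasDerivAt_deriv hr t).const_sub τ).smul (hasDerivAt_deriv hs t)).add
        (hasDerivAt_cross (hasDerivAt_deriv hs' t) (hasDerivAt_deriv hs t))
    -- The tangential part of the Euler-Lagrange equation makes the twist rate constant.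
    have hr' : ∀ t, deriv f.twistRate t = 0 := fun t => by
      have h2 := congrArg (fun x => (inner ℝ x (deriv f.γ t) : ℝ)) ((hU t).deriv.symm.trans (hτ t))
      simp only [inner_add_left, inner_smul_left, conj_trivial, FramedLoop.inner_deriv_γ_self h1,
        FramedLoop.inner_deriv_deriv_γ h1, cross_self, inner_zero_left, inner_cross_comm,
        inner_zero_right] at h2
      linarith
    have hr0 : ∀ t, f.twistRate t = f.twistRate 0 := fun t =>
      is_const_of_deriv_eq_zero (hr.differentiable (by simp)) hr' t 0
    have hτr : ∀ t, f.twistRate t = τ := fun t => by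
      simp only [hr0] at hτ0 ⊢
      rw [intervalIntegral.integral_const, sub_zero, smul_eq_mul] at hτ0
      linarith
    refine ⟨exists_isCoveredCircle (B := cross (deriv (deriv f.γ) 0) (deriv f.γ 0)) h1 fun t => ?_,
      _, hr0⟩
    have hd : ∀ t, deriv (fun t => cross (deriv (deriv f.γ) t) (deriv f.γ t)) t = 0 := by
      simpa only [hτr, sub_self, zero_smul, zero_add] using hτ
    exact is_const_of_deriv_eq_zero ((contDiff_cross hs' hs).differentiable (by simp)) hd t 0
  · rintro ⟨⟨h, hh, hc⟩, τ, hτ⟩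
    rw [isCriticalPoint_iff_sympl_eq_zero]
    intro F hF hF0
    have h1 : ∀ t, f.speed t = 1 := hc.1
    obtain ⟨p, e₁, e₂, -, -, -, -, hd, hdd⟩ := hc.exists_deriv_eq hh
    have hB : ∀ t, cross (deriv (deriv f.γ) t) (deriv f.γ t) =
        -(h * Real.pi) • cross e₁ e₂ := fun t => by
      rw [hd, hdd, cross_smul_left, cross_rotate]
    have h2 := hF.integral_inner_const_eq_zero (-(h * Real.pi) • cross e₁ e₂)
    rw [Variation.sympl_eq, FramedLoop.integral_density_generator h1 hF hF0 τ]
    simp only [hτ, hB, sub_self, zero_smul, zero_add,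
      real_inner_comm (-(h * Real.pi) • cross e₁ e₂), h2, mul_zero]

/-! ### Framed loops with the same base curve -/

theorem exists_cos_sin_eq {c s : ℝ} (h : c ^ 2 + s ^ 2 = 1) :
    ∃ φ : ℝ, Real.cos φ = c ∧ Real.sin φ = s := by
  have hn : ‖(⟨c, s⟩ : ℂ)‖ = 1 := by
    rw [Complex.norm_eq_sqrt_sq_add_sq, h, Real.sqrt_one]
  have h1 := Complex.norm_mul_cos_arg ⟨c, s⟩
  have h2 := Complex.norm_mul_sin_arg ⟨c, s⟩
  rw [hn, one_mul] at h1 h2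
  exact ⟨_, h1, h2⟩

namespace FramedLoop

variable {f g : FramedLoop}

theorem T_eq_of_γ_eq (h : f.γ = g.γ) : f.T = g.T := by
  funext t
  simp only [T, speed, h]

theorem V_eq_of_γ_eq (h : f.γ = g.γ) (t : ℝ) :
    f.V t = (inner ℝ (f.V t) (g.V t) : ℝ) • g.V t + (inner ℝ (f.V t) (g.W t) : ℝ) • g.W t := by
  conv_lhs => rw [g.eq_frame_sum t (f.V t)]
  rw [← T_eq_of_γ_eq h, inner_V_T, zero_smul, zero_add]

theorem inner_sq_add_inner_sq (h : f.γ = g.γ) (t : ℝ) :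
    (inner ℝ (f.V t) (g.V t) : ℝ) ^ 2 + (inner ℝ (f.V t) (g.W t) : ℝ) ^ 2 = 1 := by
  have h1 := g.inner_eq_frame_sum t (f.V t) (f.V t)
  rw [inner_V_V, ← T_eq_of_γ_eq h, inner_V_T] at h1
  linarith

theorem inner_W_V_of_γ_eq (h : f.γ = g.γ) (t : ℝ) :
    (inner ℝ (f.W t) (g.V t) : ℝ) = -inner ℝ (f.V t) (g.W t) := by
  rw [W, W, cross_swap, inner_neg_left, inner_cross_comm, T_eq_of_γ_eq h]

theorem inner_W_W_of_γ_eq (h : f.γ = g.γ) (t : ℝ) :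
    (inner ℝ (f.W t) (g.W t) : ℝ) = inner ℝ (f.V t) (g.V t) := by
  rw [W, W, ← T_eq_of_γ_eq h, inner_cross_cross, inner_T_T, inner_V_T]
  ring

/-- Relative to a second framing of the same unit speed curve, a framing rotates with angular
velocity the difference of the twist rates. -/
theorem hasDerivAt_inner_V (h : f.γ = g.γ) (h1 : ∀ t, g.speed t = 1) (t : ℝ) :
    HasDerivAt (fun t => (inner ℝ (f.V t) (g.V t) : ℝ))
      (-(f.twistRate t - g.twistRate t) * inner ℝ (f.V t) (g.W t)) t ∧
    HasDerivAt (fun t => (inner ℝ (f.V t) (g.W t) : ℝ))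
      ((f.twistRate t - g.twistRate t) * inner ℝ (f.V t) (g.V t)) t := by
  have h1' : ∀ t, f.speed t = 1 := fun t => by rw [← h1 t, speed, h, speed]
  have hVf : ∀ x : E3, inner ℝ x (f.T t) = (0 : ℝ) →
      (inner ℝ (deriv f.V t) x : ℝ) = f.twistRate t * inner ℝ (f.W t) x := fun x hx => by
    rw [f.inner_eq_frame_sum t, inner_deriv_V_V, hx, ← twistRate_eq_inner h1',
      real_inner_comm x (f.W t)]
    ring
  have hVg : (inner ℝ (f.V t) (deriv g.V t) : ℝ) = g.twistRate t * inner ℝ (f.V t) (g.W t) := by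
    rw [g.inner_eq_frame_sum t, inner_deriv_V_V, ← T_eq_of_γ_eq h, inner_V_T,
      ← twistRate_eq_inner h1]
    ring
  have hWg : (inner ℝ (f.V t) (deriv g.W t) : ℝ) = -(g.twistRate t * inner ℝ (f.V t) (g.V t)) := by
    rw [g.inner_eq_frame_sum t, inner_deriv_W_W, inner_deriv_W_V, ← T_eq_of_γ_eq h, inner_V_T,
      ← twistRate_eq_inner h1]
    ring
  refine ⟨((hasDerivAt_deriv f.smooth_V t).inner ℝ (hasDerivAt_deriv g.smooth_V t)).congr_deriv ?_,
    ((hasDerivAt_deriv f.smooth_V t).inner ℝ (hasDerivAt_deriv g.contDiff_W t)).congr_deriv ?_⟩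
  · rw [hVg, hVf _ (by rw [T_eq_of_γ_eq h, inner_V_T]), inner_W_V_of_γ_eq h]
    ring
  · rw [hWg, hVf _ (by rw [T_eq_of_γ_eq h, inner_W_T]), inner_W_W_of_γ_eq h]
    ring

theorem equiv_of_twistRate_eq (h : f.γ = g.γ) (h1 : ∀ t, g.speed t = 1)
    (hr : ∀ t, f.twistRate t = g.twistRate t) : f ≈ g := by
  have hd := hasDerivAt_inner_V h h1
  simp only [hr, sub_self, neg_zero, zero_mul] at hd
  obtain ⟨φ, hc, hs⟩ := exists_cos_sin_eq (inner_sq_add_inner_sq h 0)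
  refine Setoid.symm ⟨1, 0, φ / 2, fun t => ⟨by rw [rot_one, add_zero, h], ?_⟩⟩
  rw [rot_one, mul_div_cancel₀ φ two_ne_zero, hc, hs, V_eq_of_γ_eq h,
    is_const_of_deriv_eq_zero (fun t => (hd t).1.differentiableAt) (fun t => (hd t).1.deriv) t 0,
    is_const_of_deriv_eq_zero (fun t => (hd t).2.differentiableAt) (fun t => (hd t).2.deriv) t 0]

/-- Since both framings close up, their constant twist rates differ by a multiple of `π`. -/
theorem exists_int_of_twistRate_const (h : f.γ = g.γ) (h1 : ∀ t, g.speed t = 1) {δ : ℝ}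
    (hr : ∀ t, f.twistRate t - g.twistRate t = δ) : ∃ n : ℤ, δ = n * Real.pi := by
  have hd := hasDerivAt_inner_V h h1
  simp only [hr] at hd
  have hcos := hasDerivAt_cos_mul δ
  have hsin := hasDerivAt_sin_mul δ
  have hd' : ∀ t, HasDerivAt (fun t => Real.cos (δ * t) * inner ℝ (f.V t) (g.V t) +
      Real.sin (δ * t) * inner ℝ (f.V t) (g.W t)) 0 t := fun t =>
    (((hcos t).mul (hd t).1).add ((hsin t).mul (hd t).2)).congr_deriv (by ring)
  have hd'' : ∀ t, HasDerivAt (fun t => Real.cos (δ * t) * inner ℝ (f.V t) (g.W t) -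
      Real.sin (δ * t) * inner ℝ (f.V t) (g.V t)) 0 t := fun t =>
    (((hcos t).mul (hd t).2).sub ((hsin t).mul (hd t).1)).congr_deriv (by ring)
  have e1 := is_const_of_deriv_eq_zero (fun t => (hd' t).differentiableAt)
    (fun t => (hd' t).deriv) 2 0
  have e2 := is_const_of_deriv_eq_zero (fun t => (hd'' t).differentiableAt)
    (fun t => (hd'' t).deriv) 2 0
  have p1 := f.periodic_V 0
  have p2 := g.periodic_V 0
  have p3 := g.W_periodic 0
  rw [zero_add] at p1 p2 p3
  simp only [p1, p2, p3, mul_zero, Real.cos_zero, Real.sin_zero] at e1 e2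
  have e3 := inner_sq_add_inner_sq h 0
  have e4 : Real.cos (δ * 2) = 1 := by
    linear_combination (inner ℝ (f.V 0) (g.V 0) : ℝ) * e1 + (inner ℝ (f.V 0) (g.W 0) : ℝ) * e2 -
      (Real.cos (δ * 2) - 1) * e3
  obtain ⟨n, hn⟩ := (Real.cos_eq_one_iff _).1 e4
  exact ⟨n, by linarith⟩

end FramedLoop

/-! ### Covered circles with a uniformly rotating framing -/

theorem periodic_cos_int (k : ℤ) : Function.Periodic (fun t => Real.cos (k * Real.pi * t)) 2 :=
  fun t => by
    change Real.cos (k * Real.pi * (t + 2)) = Real.cos (k * Real.pi * t)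
    rw [← Real.cos_add_int_mul_two_pi (k * Real.pi * t) k]
    congr 1
    ring

theorem periodic_sin_int (k : ℤ) : Function.Periodic (fun t => Real.sin (k * Real.pi * t)) 2 :=
  fun t => by
    change Real.sin (k * Real.pi * (t + 2)) = Real.sin (k * Real.pi * t)
    rw [← Real.sin_add_int_mul_two_pi (k * Real.pi * t) k]
    congr 1
    ring

theorem contDiff_cos_mul (a : ℝ) : ContDiff ℝ ∞ fun t => Real.cos (a * t) :=
  Real.contDiff_cos.comp (contDiff_const.mul contDiff_id)

theorem contDiff_sin_mul (a : ℝ) : ContDiff ℝ ∞ fun t => Real.sin (a * t) :=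
  Real.contDiff_sin.comp (contDiff_const.mul contDiff_id)

/-- An orthonormal pair of vectors of Euclidean 3-space. -/
structure IsOrthonormalPair (e₁ e₂ : E3) : Prop where
  fst : inner ℝ e₁ e₁ = (1 : ℝ)
  snd : inner ℝ e₂ e₂ = (1 : ℝ)
  inner : inner ℝ e₁ e₂ = (0 : ℝ)

namespace IsOrthonormalPair

variable {e₁ e₂ : E3} (he : IsOrthonormalPair e₁ e₂)
include he

theorem inner' : Inner.inner ℝ e₂ e₁ = (0 : ℝ) := by rw [real_inner_comm, he.inner]

theorem inner_cross_self : Inner.inner ℝ (cross e₁ e₂) (cross e₁ e₂) = (1 : ℝ) := by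
  rw [inner_cross_cross, he.fst, he.snd, he.inner]; norm_num

/-- Rotating an orthonormal pair in its plane gives an orthonormal pair. -/
theorem rotate (φ : ℝ) : IsOrthonormalPair (Real.cos φ • e₁ + Real.sin φ • e₂)
    (-Real.sin φ • e₁ + Real.cos φ • e₂) := by
  have h := Real.cos_sq_add_sin_sq φ
  constructor <;> simp only [inner_add_left, inner_add_right, inner_smul_left, inner_smul_right,
    he.fst, he.snd, he.inner, he.inner', conj_trivial] <;> linarith

theorem norm_neg_add (φ : ℝ) :
    ‖-(Real.sin φ • cross e₁ e₂ + Real.cos φ • e₁)‖ = 1 := by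
  have h := Real.cos_sq_add_sin_sq φ
  have h0 := inner_cross_left e₁ e₂
  have h0' := h0
  rw [real_inner_comm] at h0'
  rw [norm_neg, norm_eq_sqrt_real_inner, Real.sqrt_eq_one]
  simp only [inner_add_left, inner_add_right, inner_smul_left, inner_smul_right, he.fst, h0, h0',
    he.inner_cross_self, conj_trivial]
  linarith

theorem inner_neg_add (φ : ℝ) :
    Inner.inner ℝ e₂ (-(Real.sin φ • cross e₁ e₂ + Real.cos φ • e₁)) = (0 : ℝ) := by
  rw [inner_neg_right, inner_add_right, inner_smul_right, inner_smul_right, he.inner',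
    inner_cross_right]
  ring

theorem cross_neg_add (φ : ℝ) : cross e₂ (-(Real.sin φ • cross e₁ e₂ + Real.cos φ • e₁)) =
    Real.cos φ • cross e₁ e₂ - Real.sin φ • e₁ := by
  have h : cross e₂ (cross e₁ e₂) = e₁ := by
    rw [cross_cross_left, he.snd, he.inner']; simp
  rw [← neg_one_smul ℝ, cross_smul_right, cross_add_right, cross_smul_right, cross_smul_right, h,
    cross_swap e₂ e₁]
  module

end IsOrthonormalPair

theorem hasDerivAt_normal (κ : ℝ) (e₁ e₂ : E3) (t : ℝ) :
    HasDerivAt (fun t => Real.cos (κ * t) • e₁ + Real.sin (κ * t) • e₂)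
      (κ • (-Real.sin (κ * t) • e₁ + Real.cos (κ * t) • e₂)) t :=
  (((hasDerivAt_cos_mul κ t).smul_const e₁).add
    ((hasDerivAt_sin_mul κ t).smul_const e₂)).congr_deriv (by module)

theorem hasDerivAt_circle {κ : ℝ} (hκ : κ ≠ 0) (p e₁ e₂ : E3) (t : ℝ) :
    HasDerivAt (fun t => p + κ⁻¹ • (Real.cos (κ * t) • e₁ + Real.sin (κ * t) • e₂))
      (-Real.sin (κ * t) • e₁ + Real.cos (κ * t) • e₂) t := by
  have h := ((hasDerivAt_normal κ e₁ e₂ t).const_smul κ⁻¹).const_add p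
  rwa [inv_smul_smul₀ hκ] at h

theorem natCast_mul_pi_ne_zero {h : ℕ} (hh : 0 < h) : h * Real.pi ≠ 0 := by positivity

/-- The `h`-times covered unit speed circle with center `p` in the plane of `e₁, e₂`, with the
framing that starts at the inward normal and rotates around the tangent at the constant rate
`-k π` relative to it. -/
def circleLoop {h : ℕ} (hh : 0 < h) (k : ℤ) (p : E3) {e₁ e₂ : E3} (he : IsOrthonormalPair e₁ e₂) :
    FramedLoop where
  γ t := p + (h * Real.pi)⁻¹ • (Real.cos (h * Real.pi * t) • e₁ + Real.sin (h * Real.pi * t) • e₂)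
  V t := -(Real.sin (k * Real.pi * t) • cross e₁ e₂ + Real.cos (k * Real.pi * t) •
    (Real.cos (h * Real.pi * t) • e₁ + Real.sin (h * Real.pi * t) • e₂))
  smooth_γ := contDiff_const.add ((((contDiff_cos_mul _).smul contDiff_const).add
    ((contDiff_sin_mul _).smul contDiff_const)).const_smul _)
  smooth_V := (((contDiff_sin_mul _).smul contDiff_const).add ((contDiff_cos_mul _).smul
    (((contDiff_cos_mul _).smul contDiff_const).add
      ((contDiff_sin_mul _).smul contDiff_const)))).neg
  periodic_γ t := by
    have h1 := periodic_cos_int h t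
    have h2 := periodic_sin_int h t
    simp only [Int.cast_natCast] at h1 h2
    simp only [h1, h2]
  periodic_V t := by
    have h1 := periodic_cos_int h t
    have h2 := periodic_sin_int h t
    have h3 := periodic_cos_int k t
    have h4 := periodic_sin_int k t
    simp only [Int.cast_natCast] at h1 h2 h3 h4
    simp only [h1, h2, h3, h4]
  immersed t := by
    rw [(hasDerivAt_circle (natCast_mul_pi_ne_zero hh) p e₁ e₂ t).deriv,
      ← inner_self_ne_zero (𝕜 := ℝ), (he.rotate _).snd]
    exact one_ne_zero
  unit_V t := by
    rw [← cross_rotate (h * Real.pi * t)]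
    exact (he.rotate _).norm_neg_add _
  normal_V t := by
    rw [(hasDerivAt_circle (natCast_mul_pi_ne_zero hh) p e₁ e₂ t).deriv,
      ← cross_rotate (h * Real.pi * t)]
    exact (he.rotate _).inner_neg_add _
  length_eq := by
    simp only [fun t => (hasDerivAt_circle (natCast_mul_pi_ne_zero hh) p e₁ e₂ t).deriv,
      norm_eq_sqrt_real_inner, (he.rotate _).snd, Real.sqrt_one]
    simp

section CircleLoop

variable {h : ℕ} (hh : 0 < h) (k : ℤ) (p : E3) {e₁ e₂ : E3} (he : IsOrthonormalPair e₁ e₂)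

theorem deriv_γ_circleLoop (t : ℝ) : deriv (circleLoop hh k p he).γ t =
    -Real.sin (h * Real.pi * t) • e₁ + Real.cos (h * Real.pi * t) • e₂ :=
  (hasDerivAt_circle (natCast_mul_pi_ne_zero hh) p e₁ e₂ t).deriv

theorem speed_circleLoop (t : ℝ) : (circleLoop hh k p he).speed t = 1 := by
  rw [FramedLoop.speed, deriv_γ_circleLoop, norm_eq_sqrt_real_inner, (he.rotate _).snd,
    Real.sqrt_one]

theorem isCoveredCircle_circleLoop : IsCoveredCircle h (circleLoop hh k p he).γ :=
  ⟨speed_circleLoop hh k p he, p, e₁, e₂, (h * Real.pi)⁻¹, by positivity,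
    by rw [norm_eq_sqrt_real_inner, he.fst, Real.sqrt_one],
    by rw [norm_eq_sqrt_real_inner, he.snd, Real.sqrt_one], he.inner, fun _ => rfl⟩

theorem twistRate_circleLoop (t : ℝ) :
    (circleLoop hh k p he).twistRate t = -(Real.pi * k) := by
  have hr := he.rotate (h * Real.pi * t)
  have hV : HasDerivAt (circleLoop hh k p he).V _ t :=
    (((hasDerivAt_sin_mul (k * Real.pi) t).smul_const (cross e₁ e₂)).add
      ((hasDerivAt_cos_mul (k * Real.pi) t).smul (hasDerivAt_normal (h * Real.pi) e₁ e₂ t))).neg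
  have hW : (circleLoop hh k p he).W t = Real.cos (k * Real.pi * t) • cross e₁ e₂ -
      Real.sin (k * Real.pi * t) •
        (Real.cos (h * Real.pi * t) • e₁ + Real.sin (h * Real.pi * t) • e₂) := by
    rw [FramedLoop.W, FramedLoop.T_eq_deriv (speed_circleLoop hh k p he), deriv_γ_circleLoop,
      ← cross_rotate (h * Real.pi * t) e₁ e₂]
    rw [← hr.cross_neg_add]
    simp only [circleLoop, cross_rotate]
  rw [FramedLoop.twistRate_eq_inner (speed_circleLoop hh k p he), hV.deriv, hW,
    ← cross_rotate (h * Real.pi * t) e₁ e₂]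
  set N := Real.cos (h * Real.pi * t) • e₁ + Real.sin (h * Real.pi * t) • e₂
  set T := -Real.sin (h * Real.pi * t) • e₁ + Real.cos (h * Real.pi * t) • e₂
  have h1 := inner_cross_left N T
  have h2 := inner_cross_right N T
  have h1' := h1
  rw [real_inner_comm] at h1'
  have h3 := Real.cos_sq_add_sin_sq (k * Real.pi * t)
  simp only [inner_neg_left, inner_add_left, inner_sub_right, inner_smul_left, inner_smul_right,
    conj_trivial, h1, h1', h2, hr.fst, hr.inner', hr.inner_cross_self]
  linear_combination -(k * Real.pi) * h3

end CircleLoop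

theorem exists_rot {e₁ e₂ : E3} (he : IsOrthonormalPair e₁ e₂) :
    ∃ A : SO3, rot A !₂[0, -1, 0] = e₁ ∧ rot A !₂[0, 0, 1] = e₂ := by
  let m : Matrix (Fin 3) (Fin 3) ℝ := Matrix.of fun i j => ![-(cross e₁ e₂) i, -e₁ i, e₂ i] j
  have hm : m ∈ Matrix.specialOrthogonalGroup (Fin 3) ℝ := by
    have h1 := he.fst
    have h2 := he.snd
    have h3 := he.inner
    have h4 := he.inner_cross_self
    rw [inner_eq] at h1 h2 h3 h4
    rw [Matrix.mem_specialOrthogonalGroup_iff]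
    constructor
    · rw [Matrix.mem_orthogonalGroup_iff']
      ext i j
      fin_cases i <;> fin_cases j <;>
        simp [m, Matrix.mul_apply, Fin.sum_univ_three, cross, cross_apply] at h4 ⊢ <;>
        linarith
    · rw [Matrix.det_fin_three]
      simp [m, cross, cross_apply] at h4 ⊢
      linarith
  refine ⟨⟨m, hm⟩, ?_, ?_⟩ <;> ext i <;> fin_cases i <;>
    simp [rot, m, Matrix.toLpLin_apply]

theorem isOrthonormalPair_std : IsOrthonormalPair !₂[0, -1, 0] !₂[0, 0, 1] := by
  constructor <;> rw [inner_eq] <;> simp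

/-- All circles with the same winding number and twist rate represent the same point. -/
theorem circleLoop_equiv {h : ℕ} (hh : 0 < h) (k : ℤ) (p p' : E3) {e₁ e₂ e₁' e₂' : E3}
    (he : IsOrthonormalPair e₁ e₂) (he' : IsOrthonormalPair e₁' e₂') :
    circleLoop hh k p he ≈ circleLoop hh k p' he' := by
  have key : ∀ {e₁ e₂ : E3} (he : IsOrthonormalPair e₁ e₂) (p : E3),
      circleLoop hh k 0 isOrthonormalPair_std ≈ circleLoop hh k p he := fun he p => by
    obtain ⟨A, h1, h2⟩ := exists_rot he
    refine ⟨A, p, 0, fun t => ⟨?_, ?_⟩⟩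
    · simp only [circleLoop, map_add, map_smul, h1, h2, zero_add]
      rw [add_comm]
    · simp only [mul_zero, Real.cos_zero, Real.sin_zero, one_smul, zero_smul, add_zero]
      simp only [circleLoop, map_neg, map_add, map_smul, ← cross_rot, h1, h2]
  exact Setoid.trans (Setoid.symm (key he p)) (key he' p')

theorem IsCoveredCircle.of_equiv {f g : FramedLoop} {h : ℕ} (hf : IsCoveredCircle h f.γ)
    (hfg : f ≈ g) : IsCoveredCircle h g.γ := by
  obtain ⟨A, b, θ, hA⟩ := (hfg : FramedLoop.Rel f g)
  obtain ⟨h1, p, e₁, e₂, R, hR, he₁, he₂, he, hγ⟩ := hf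
  refine ⟨fun t => ?_, rot A p + b, rot A e₁, rot A e₂, R, hR, by rw [norm_rot, he₁],
    by rw [norm_rot, he₂], by rw [inner_rot, he], fun t => ?_⟩
  · rw [FramedLoop.deriv_γ_of_eq (fun t => (hA t).1), norm_rot, h1]
  · rw [(hA t).1, hγ]
    simp only [map_add, map_smul]
    abel

/-- A covered circle has the base curve of a standard covered circle. -/
theorem IsCoveredCircle.exists_circleLoop {f : FramedLoop} {h : ℕ} (hh : 0 < h)
    (hf : IsCoveredCircle h f.γ) : ∃ (p e₁ e₂ : E3) (he : IsOrthonormalPair e₁ e₂),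
      ∀ k, f.γ = (circleLoop hh k p he).γ := by
  obtain ⟨p, e₁, e₂, he₁, he₂, he, hγ, -, -⟩ := hf.exists_deriv_eq hh
  exact ⟨p, e₁, e₂, ⟨by rw [real_inner_self_eq_norm_sq, he₁, one_pow],
    by rw [real_inner_self_eq_norm_sq, he₂, one_pow], he⟩, fun k => funext hγ⟩

/-! ### Torus knots -/

theorem torusKnot_eq (h : ℕ) (k : ℤ) (t : ℝ) : torusKnot h k t =
    ((1 / Real.sqrt 2 : ℝ) * Complex.exp (((k + h) * Real.pi * t / 2 : ℝ) * Complex.I),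
      (1 / Real.sqrt 2 : ℝ) * Complex.exp (((k - h) * Real.pi * t / 2 : ℝ) * Complex.I)) := by
  rw [torusKnot]
  congr 3 <;> push_cast <;> ring

theorem one_div_sqrt_two_sq : (1 / Real.sqrt 2 : ℝ) ^ 2 = 1 / 2 := by
  rw [div_pow, Real.sq_sqrt zero_le_two, one_pow]

theorem norm_sq_torusKnot (h : ℕ) (k : ℤ) (t : ℝ) :
    ‖(torusKnot h k t).1‖ ^ 2 = 1 / 2 ∧ ‖(torusKnot h k t).2‖ ^ 2 = 1 / 2 := by
  rw [torusKnot_eq]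
  simp only [norm_mul, Complex.norm_exp_ofReal_mul_I, Complex.norm_real, Real.norm_eq_abs, mul_one,
    sq_abs, one_div_sqrt_two_sq, and_self]

theorem hopf₁_polar (c α β : ℝ) :
    hopf₁ (c * Complex.exp (α * Complex.I), c * Complex.exp (β * Complex.I)) =
      !₂[0, 2 * c ^ 2 * Real.sin (α - β), 2 * c ^ 2 * Real.cos (α - β)] := by
  rw [hopf₁, Real.sin_sub, Real.cos_sub]
  ext i
  fin_cases i
  · simp [Complex.norm_exp_ofReal_mul_I]
  · simp [Complex.exp_ofReal_mul_I_re, Complex.exp_ofReal_mul_I_im]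
    ring
  · simp [Complex.exp_ofReal_mul_I_re, Complex.exp_ofReal_mul_I_im]
    ring

theorem hopf₂_polar (c α β : ℝ) :
    hopf₂ (c * Complex.exp (α * Complex.I), c * Complex.exp (β * Complex.I)) =
      !₂[2 * c ^ 2 * Real.sin (α + β), 2 * c ^ 2 * (Real.cos (α + β) * Real.cos (α - β)),
        -(2 * c ^ 2 * (Real.cos (α + β) * Real.sin (α - β)))] := by
  have h1 := Real.cos_sq_add_sin_sq α
  have h2 := Real.cos_sq_add_sin_sq β
  rw [hopf₂, Real.sin_sub, Real.cos_sub, Real.sin_add, Real.cos_add]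
  ext i
  fin_cases i
  · simp [Complex.exp_ofReal_mul_I_re, Complex.exp_ofReal_mul_I_im]
    ring
  · simp [Complex.exp_ofReal_mul_I_re, Complex.exp_ofReal_mul_I_im, pow_two]
    linear_combination c ^ 2 * (Real.sin α ^ 2 - Real.cos α ^ 2) * h2 +
      c ^ 2 * (Real.sin β ^ 2 - Real.cos β ^ 2) * h1
  · simp [Complex.exp_ofReal_mul_I_re, Complex.exp_ofReal_mul_I_im, pow_two]
    linear_combination 2 * c ^ 2 * Real.sin α * Real.cos α * h2 -
      2 * c ^ 2 * Real.sin β * Real.cos β * h1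

theorem hopf₁_torusKnot (h : ℕ) (k : ℤ) (t : ℝ) : hopf₁ (torusKnot h k t) =
    -Real.sin (h * Real.pi * t) • !₂[0, -1, 0] + Real.cos (h * Real.pi * t) • !₂[0, 0, 1] := by
  have e : (k + h) * Real.pi * t / 2 - (k - h) * Real.pi * t / 2 = h * Real.pi * t := by ring
  rw [torusKnot_eq, hopf₁_polar, one_div_sqrt_two_sq, e]
  ext i; fin_cases i <;> simp

theorem framing_torusKnot {h : ℕ} (hh : 0 < h) (k : ℤ) (p : E3) :
    framing (torusKnot h k) = (circleLoop hh k p isOrthonormalPair_std).V := by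
  funext t
  have e : (k + h) * Real.pi * t / 2 - (k - h) * Real.pi * t / 2 = h * Real.pi * t := by ring
  have e' : (k + h) * Real.pi * t / 2 + (k - h) * Real.pi * t / 2 = k * Real.pi * t := by ring
  rw [framing, (norm_sq_torusKnot h k t).1, (norm_sq_torusKnot h k t).2, torusKnot_eq, hopf₂_polar,
    one_div_sqrt_two_sq, e, e']
  ext i
  fin_cases i
  · norm_num [circleLoop, cross, cross_apply]
    exact (mul_one _).symm
  · norm_num [circleLoop, cross, cross_apply]
  · norm_num [circleLoop, cross, cross_apply]

theorem baseCurve_torusKnot {h : ℕ} (hh : 0 < h) (k : ℤ) : baseCurve (torusKnot h k) =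
    (circleLoop hh k (-(h * Real.pi)⁻¹ • !₂[0, -1, 0]) isOrthonormalPair_std).γ := by
  funext t
  rw [baseCurve]
  simp only [hopf₁_torusKnot]
  rw [intervalIntegral.integral_eq_sub_of_hasDerivAt (fun s _ => hasDerivAt_circle
    (natCast_mul_pi_ne_zero hh) (-(h * Real.pi)⁻¹ • !₂[0, -1, 0]) !₂[0, -1, 0] !₂[0, 0, 1] s)]
  · simp only [circleLoop, mul_zero, Real.cos_zero, Real.sin_zero]
    module
  · exact (((contDiff_sin_mul _).neg.smul contDiff_const).add
      ((contDiff_cos_mul _).smul contDiff_const)).continuous.intervalIntegrable _ _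

/-- The torus knots represent exactly the circles with a uniformly rotating framing. -/
theorem represents_torusKnot_iff {h : ℕ} (hh : 0 < h) (k : ℤ) (m : M) :
    Represents (torusKnot h k) m ↔
      m = toM (circleLoop hh k (-(h * Real.pi)⁻¹ • !₂[0, -1, 0]) isOrthonormalPair_std) := by
  constructor
  · rintro ⟨f, hγ, hV, rfl⟩
    exact congrArg toM (FramedLoop.ext (hγ.trans (baseCurve_torusKnot hh k))
      (hV.trans (framing_torusKnot hh k _)))
  · rintro rfl
    exact ⟨_, (baseCurve_torusKnot hh k).symm, (framing_torusKnot hh k _).symm, rfl⟩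

theorem represents_torusKnot_toM_iff {h : ℕ} (hh : 0 < h) (k : ℤ) (f : FramedLoop) :
    Represents (torusKnot h k) (toM f) ↔
      IsCoveredCircle h f.γ ∧ ∀ t, f.twistRate t = -(Real.pi * k) := by
  rw [represents_torusKnot_iff hh]
  constructor
  · intro hf
    have he := Setoid.symm (Quotient.exact hf)
    exact ⟨(isCoveredCircle_circleLoop hh k _ _).of_equiv he, fun t => by
      rw [FramedLoop.twistRate_eq he, twistRate_circleLoop]⟩
  · rintro ⟨hf, hr⟩
    obtain ⟨p, e₁, e₂, he, hγ⟩ := hf.exists_circleLoop hh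
    refine Quotient.sound (Setoid.trans (b := circleLoop hh k p he) ?_
      (circleLoop_equiv hh k _ _ _ _))
    exact FramedLoop.equiv_of_twistRate_eq (hγ k) (speed_circleLoop hh k p he) fun t => by
      rw [hr, twistRate_circleLoop]

theorem isCriticalPoint_iff_represents (m : M) : IsCriticalPoint weightedTotalTwist m ↔
    ∃ (h : ℕ) (k : ℤ), 0 < h ∧ Represents (torusKnot h k) m := by
  induction m using Quotient.inductionOn with
  | h f =>
    refine (isCriticalPoint_iff f).trans ⟨?_, ?_⟩
    · rintro ⟨⟨h, hh, hf⟩, τ, hτ⟩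
      obtain ⟨p, e₁, e₂, he, hγ⟩ := hf.exists_circleLoop hh
      obtain ⟨n, hn⟩ := FramedLoop.exists_int_of_twistRate_const (hγ 0)
        (speed_circleLoop hh 0 p he) (δ := τ) fun t => by
          rw [hτ, twistRate_circleLoop]; simp
      refine ⟨h, -n, hh, (represents_torusKnot_toM_iff hh _ f).2 ⟨hf, fun t => ?_⟩⟩
      rw [hτ, hn]
      push_cast
      ring
    · rintro ⟨h, k, hh, hm⟩
      obtain ⟨hf, hr⟩ := (represents_torusKnot_toM_iff hh k f).1 hm
      exact ⟨⟨h, hh, hf⟩, _, hr⟩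

theorem isStiefelFrame_torusKnot {h : ℕ} (hh : 0 < h) (k : ℤ) :
    IsStiefelFrame (torusKnot h k) where
  smooth := by
    have ht : ContDiff ℝ ∞ fun t : ℝ => (t : ℂ) := Complex.ofRealCLM.contDiff
    exact (contDiff_const.mul (contDiff_const.mul ht).cexp).prodMk
      (contDiff_const.mul (contDiff_const.mul ht).cexp)
  closed := by
    -- Both components are multiplied by the same sign over a period.
    set σ := Complex.exp ((k + h) * (Real.pi * Complex.I)) with hσ
    have hσ2 : σ ^ 2 = 1 := by
      rw [hσ, ← Complex.exp_nat_mul, ← Complex.exp_int_mul_two_pi_mul_I (k + h)]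
      congr 1
      push_cast
      ring
    have hσ' : Complex.exp ((k - h) * (Real.pi * Complex.I)) = σ := by
      rw [hσ, ← mul_one (Complex.exp ((k - h) * (Real.pi * Complex.I))),
        ← Complex.exp_int_mul_two_pi_mul_I h, ← Complex.exp_add]
      congr 1
      push_cast
      ring
    have key : ∀ t, torusKnot h k (t + 2) =
        (σ * (torusKnot h k t).1, σ * (torusKnot h k t).2) := fun t => by
      rw [torusKnot, torusKnot]
      refine Prod.ext ?_ ?_
      · dsimp only
        rw [hσ, mul_left_comm, ← Complex.exp_add]
        congr 2
        push_cast
        ring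
      · dsimp only
        rw [← hσ', mul_left_comm, ← Complex.exp_add]
        congr 2
        push_cast
        ring
    rcases mul_self_eq_one_iff.1 ((pow_two σ).symm.trans hσ2) with h1 | h1
    · exact Or.inl fun t => by rw [key, h1, one_mul, one_mul]
    · exact Or.inr fun t => by rw [key, h1, neg_one_mul, neg_one_mul]; rfl
  ne_zero t h0 := by
    have h1 := (norm_sq_torusKnot h k t).1
    rw [h0] at h1
    norm_num at h1
  norm_fst := by
    simp only [fun t => (norm_sq_torusKnot h k t).1]
    norm_num
  norm_snd := by
    simp only [fun t => (norm_sq_torusKnot h k t).2]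
    norm_num
  orthogonal := by
    have hc : (h * Real.pi * Complex.I : ℂ) ≠ 0 :=
      mul_ne_zero (by exact_mod_cast natCast_mul_pi_ne_zero hh) Complex.I_ne_zero
    have key : ∀ t, (torusKnot h k t).1 * star (torusKnot h k t).2 =
        (1 / 2 : ℂ) * Complex.exp (h * Real.pi * Complex.I * t) := fun t => by
      have h2 : ((1 / Real.sqrt 2 : ℝ) : ℂ) * (1 / Real.sqrt 2 : ℝ) = 1 / 2 := by
        rw [← pow_two, ← Complex.ofReal_pow, one_div_sqrt_two_sq]
        norm_num
      rw [torusKnot_eq]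
      simp only [star_mul', Complex.star_def, Complex.conj_ofReal, ← Complex.exp_conj, map_mul,
        Complex.conj_I]
      rw [mul_mul_mul_comm, h2, ← Complex.exp_add]
      congr 2
      push_cast
      ring
    simp only [key]
    rw [intervalIntegral.integral_const_mul, integral_exp_mul_complex hc]
    have h3 : Complex.exp (h * Real.pi * Complex.I * (2 : ℝ)) = 1 := by
      rw [← Complex.exp_int_mul_two_pi_mul_I h]
      congr 1
      push_cast
      ring
    rw [h3]
    simp

end FramedLoops

end

theorem theorem5p2 :
    (∀ c₁ c₂ : ℝ → M, SmoothPath c₁ → SmoothPath c₂ → c₁ 0 = c₂ 0 → ∃! a, OmegaValue c₁ c₂ a) ∧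
    IsHamiltonianWithMomentMap (fun m => -(Real.pi / 2) * weightedTotalTwist m) ∧
    (∀ f : FramedLoop, IsCriticalPoint weightedTotalTwist (toM f) ↔
      (∃ h : ℕ, 0 < h ∧ IsCoveredCircle h f.γ) ∧ ∃ τ : ℝ, ∀ t, f.twistRate t = τ) ∧
    (∀ m : M, IsCriticalPoint weightedTotalTwist m ↔
      ∃ (h : ℕ) (k : ℤ), 0 < h ∧ Represents (torusKnot h k) m) ∧
    (∀ (h : ℕ) (k : ℤ), 0 < h →
      IsStiefelFrame (torusKnot h k) ∧ (∀ t, torusKnot h k t ∈ cliffordTorus) ∧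
      (∃! m : M, Represents (torusKnot h k) m) ∧
      ∀ f : FramedLoop, Represents (torusKnot h k) (toM f) ↔
        IsCoveredCircle h f.γ ∧ ∀ t, f.twistRate t = -(Real.pi * k)) := by
  refine ⟨fun _ _ h₁ h₂ h => existsUnique_omegaValue h₁ h₂ h, isHamiltonianWithMomentMap,
    isCriticalPoint_iff, isCriticalPoint_iff_represents, fun h k hh =>
      ⟨isStiefelFrame_torusKnot hh k, norm_sq_torusKnot h k, ?_,
        represents_torusKnot_toM_iff hh k⟩⟩
  simp only [represents_torusKnot_iff hh]
  exact ⟨_, rfl, fun _ h => h⟩
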